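/- Let $G=(V,E)$ be a finite simple graph with $n$ nodes and maximum degree $\Delta\ge 1$, let $k\ge 1$ be an integer, let $\varepsilon>0$ with $\varepsilon\in\left[6\sqrt{k\ln k/n},\,1\right]$, and put $L=\ln\frac{\Delta k}{\varepsilon}$. **Definitions.** For $S\subseteq V$ let $u_i(S)$ be the number of neighbours of $i$ in $S$. For a partition $X=(X_1,\dots,X_k)$ of $V$ (parts may be empty) let $u_i(X)=u_i(X_j)$, where $i\in X_j$. Let $I_\varepsilon=\left[\lfloor(1-\varepsilon)\frac nk\rfloor,\lceil(1+\varepsilon)\frac nk\rceil\right]$. * $X$ is $\varepsilon$-balanced if $|X_j|\in I_\varepsilon$ for all $j$. * $X$ is $r$-envy-free if $u_i(X_j)-u_i(X)\le r$ for all $i\in V$ and all $j$. * An $\varepsilon$-balanced $X$ is in the $(\alpha,\beta)$-core if there is no nonempty $S\subseteq V$ with $|S|\in I_\varepsilon$ and $u_i(S)>\alpha\,u_i(X)+\beta$ for all $i\in S$. * The node event of $i\in V$ is that $\deg(i)\ge 12kL$ and $\left|u_i(X_j)-\frac{\deg(i)}k\right|>4\sqrt{\frac{\deg(i)}k L}$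 for some $j$. The global event is that $X$ is not $\varepsilon$-balanced. * $X$ is $\varepsilon$-desirable if none of these bad events occurs. **Algorithm.** Start by assigning to each node independently a uniformly random part. While some bad event occurs, do the following (one iteration): if the global event is true, draw new independent uniformly random parts for all nodes; then, if some node event is true, select a node $i$ whose event is true and draw new independent uniformly random parts for $i$ and all its neighbours. Return $X$ when no bad event occurs. The node may be selected by any rule that depends only on the current and the earlier partitions of the run. **Theorem.** 1. There is an $\varepsilon$-desirable partition. Every $\varepsilon$-desirable partition is $\varepsilon$-balanced, $\left(12\max\{\sqrt{\Delta/k},\,k\}\,L\right)$-envy-free and in the $\left(k+\sqrt k,\;16k^{3/2}L\right)$-core. In particular there is an $\varepsilon$-balanced partition that is $O\!\left(\max\{\sqrt{\Delta/k},k\}\ln\frac{\Delta k}{\varepsilon}\right)$-envy-free and in the $\left(k+\sqrt k,\,O(k^{3/2}\ln\frac{\Delta k}{\varepsilon})\right)$-core. 2. For every selection rule the algorithm terminates with probability $1$, its expected number of iterations is at most $n\cdot\frac{\varepsilon^2}{k\Delta^2}+1\le n+1=O(n)$, and whenever it terminates it returns an $\varepsilon$-desirable partition, which thus has the properties in part 1.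 -/

import Mathlib

open MeasureTheory
open scoped ENNReal

noncomputable section

namespace FairPartition

variable {V : Type*} [Fintype V] {k : ℕ}

/-- `E(i, S)`, the utility `u_i(S)` of node `i` for the set `S`: the number of edges from `i`
into `S`. -/
def edgesTo (G : SimpleGraph V) [DecidableRel G.Adj] (i : V) (S : Finset V) : ℕ :=
  (S.filter fun v => G.Adj i v).card

/-- A `k`-partition is encoded by the map `X` sending every node to the index of its part;
`part X j` is the `j`-th part. -/
def part (X : V → Fin k) (j : Fin k) : Finset V :=
  Finset.univ.filter fun v => X v = j

/-- `u_i(X)`, the utility of node `i` in the partition `X`. -/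
def utility (G : SimpleGraph V) [DecidableRel G.Adj] (X : V → Fin k) (i : V) : ℕ :=
  edgesTo G i (part X (X i))

/-- The size `m` lies in `[⌊(1 - ε) n / k⌋, ⌈(1 + ε) n / k⌉]`. -/
def SizeInRange (n k : ℕ) (ε : ℝ) (m : ℕ) : Prop :=
  ⌊(1 - ε) * ((n : ℝ) / k)⌋ ≤ (m : ℤ) ∧ (m : ℤ) ≤ ⌈(1 + ε) * ((n : ℝ) / k)⌉

/-- The partition `X` is `ε`-balanced. -/
def IsBalanced (ε : ℝ) (X : V → Fin k) : Prop :=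
  ∀ j : Fin k, SizeInRange (Fintype.card V) k ε (part X j).card

/-- The partition `X` is `r`-envy-free. -/
def IsEnvyFree (G : SimpleGraph V) [DecidableRel G.Adj] (r : ℝ) (X : V → Fin k) : Prop :=
  ∀ (i : V) (j : Fin k), (edgesTo G i (part X j) : ℝ) - utility G X i ≤ r

/-- `S` is a (nonempty) `(α, β)`-blocking set for the partition `X`. -/
def IsBlocking (G : SimpleGraph V) [DecidableRel G.Adj] (α β : ℝ) (X : V → Fin k)
    (S : Finset V) : Prop :=
  S.Nonempty ∧ ∀ i ∈ S, α * utility G X i + β < edgesTo G i S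

/-- The `(α, β)`-core condition for `ε`-balanced partitions: no coalition of `ε`-balanced size is
`(α, β)`-blocking. -/
def InCore (G : SimpleGraph V) [DecidableRel G.Adj] (ε α β : ℝ) (X : V → Fin k) : Prop :=
  ∀ S : Finset V, SizeInRange (Fintype.card V) k ε S.card → ¬ IsBlocking G α β X S

/-- The quantity `ln (Δ k / ε)`. -/
def logTerm (G : SimpleGraph V) [DecidableRel G.Adj] (k : ℕ) (ε : ℝ) : ℝ :=
  Real.log ((G.maxDegree : ℝ) * k / ε)

/-- The bad event of node `i`: it has degree at least `12 k ln (Δ k / ε)` and for some part its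
number of neighbours there is farther than `4 √(deg(i)/k · ln (Δ k / ε))` from `deg(i)/k`. -/
def NodeEvent (G : SimpleGraph V) [DecidableRel G.Adj] (ε : ℝ) (X : V → Fin k) (i : V) : Prop :=
  12 * k * logTerm G k ε ≤ (G.degree i : ℝ) ∧
    ∃ j : Fin k, (edgesTo G i (part X j) : ℝ) ∉ Set.Icc
      ((G.degree i : ℝ) / k - 4 * √((G.degree i : ℝ) / k * logTerm G k ε))
      ((G.degree i : ℝ) / k + 4 * √((G.degree i : ℝ) / k * logTerm G k ε))

/-- `X` is `ε`-desirable: it is `ε`-balanced, and for each node of degree at least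
`12 k ln (Δ k / ε)` the number of its neighbours in each part is within
`4 √(deg(i)/k · ln (Δ k / ε))` of `deg(i)/k`. -/
def IsDesirable (G : SimpleGraph V) [DecidableRel G.Adj] (ε : ℝ) (X : V → Fin k) : Prop :=
  IsBalanced ε X ∧
    ∀ i : V, 12 * k * logTerm G k ε ≤ (G.degree i : ℝ) → ∀ j : Fin k,
      (edgesTo G i (part X j) : ℝ) ∈ Set.Icc
        ((G.degree i : ℝ) / k - 4 * √((G.degree i : ℝ) / k * logTerm G k ε))
        ((G.degree i : ℝ) / k + 4 * √((G.degree i : ℝ) / k * logTerm G k ε))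

/-- Some bad event occurs, either the global one (`X` is not `ε`-balanced) or a node event. -/
def SomeBadEvent (G : SimpleGraph V) [DecidableRel G.Adj] (ε : ℝ) (X : V → Fin k) : Prop :=
  ¬ IsBalanced ε X ∨ ∃ i, NodeEvent G ε X i

/-! ### The resampling algorithm -/

/-- The random source of the algorithm: independent uniformly random parts, one infinite sequence
of them for every node. The `m`-th time that the algorithm draws a part for node `v`
(`m = 0, 1, …`), it reads the entry `(v, m)`. -/
abbrev Source (V : Type*) (k : ℕ) : Type _ := V × ℕ → Fin k

/-- The law of the random source: all entries are independent and uniform on the `k` parts. -/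
def sourceLaw (V : Type*) (k : ℕ) [NeZero k] : Measure (Source V k) :=
  Measure.infinitePi fun _ : V × ℕ => (PMF.uniformOfFintype (Fin k)).toMeasure

/-- A rule for choosing a node whose event is true, given the current partition and the list of
all earlier partitions of the run (latest first). -/
abbrev SelectionRule (V : Type*) (k : ℕ) : Type _ := (V → Fin k) → List (V → Fin k) → V

/-- The rule always selects a node whose event is true, if there is one. -/
def SelectionRule.IsValid (G : SimpleGraph V) [DecidableRel G.Adj] (ε : ℝ)
    (σ : SelectionRule V k) : Prop :=
  ∀ X past, (∃ i, NodeEvent G ε X i) → NodeEvent G ε X (σ X past)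

/-- A state of the algorithm: the current partition, the earlier partitions (latest first), and
for each node the number of parts drawn for it so far. -/
structure RunState (V : Type*) (k : ℕ) where
  current : V → Fin k
  past : List (V → Fin k)
  used : V → ℕ

/-- The initial state: one part is drawn for every node. -/
def initState (ω : Source V k) : RunState V k where
  current := fun v => ω (v, 0)
  past := []
  used := fun _ => 1

/-- Draw a new part for every node of `A`. -/
def resample [DecidableEq V] (ω : Source V k) (A : Finset V) (s : RunState V k) : RunState V k where
  current := fun v => if v ∈ A then ω (v, s.used v) else s.current v
  past := s.current :: s.past
  used := fun v => if v ∈ A then s.used v + 1 else s.used v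

open Classical in
/-- First half of the loop body: if the global event is true, resample all nodes. -/
def globalStep [DecidableEq V] (ε : ℝ) (ω : Source V k) (s : RunState V k) : RunState V k :=
  if ¬ IsBalanced ε s.current then resample ω Finset.univ s else s

open Classical in
/-- Second half of the loop body: if a node event is true, select a node `i` whose event is true
and resample `i` and all its neighbours. -/
def nodeStep [DecidableEq V] (G : SimpleGraph V) [DecidableRel G.Adj] (ε : ℝ) (σ : SelectionRule V k)
    (ω : Source V k) (s : RunState V k) : RunState V k :=
  if ∃ i, NodeEvent G ε s.current i then
    resample ω
      (insert (σ s.current s.past) (G.neighborFinset (σ s.current s.past))) s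
  else s

open Classical in
/-- The state after `t` iterations of the while loop (a state in which no bad event occurs is
final). -/
def run [DecidableEq V] (G : SimpleGraph V) [DecidableRel G.Adj] (ε : ℝ)
    (σ : SelectionRule V k) (ω : Source V k) : ℕ → RunState V k
  | 0 => initState ω
  | t + 1 =>
    if SomeBadEvent G ε (run G ε σ ω t).current then
      nodeStep G ε σ ω (globalStep ε ω (run G ε σ ω t))
    else run G ε σ ω t

/-- The number of iterations of the while loop; it is `⊤` if the loop never ends. -/
def iterations [DecidableEq V] (G : SimpleGraph V) [DecidableRel G.Adj] (ε : ℝ) (σ : SelectionRule V k)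
    (ω : Source V k) : ℕ∞ :=
  ⨅ (t : ℕ) (_ : ¬ SomeBadEvent G ε (run G ε σ ω t).current), (t : ℕ∞)

/-- The algorithm terminates and returns the partition `X`. -/
def Returns [DecidableEq V] (G : SimpleGraph V) [DecidableRel G.Adj] (ε : ℝ) (σ : SelectionRule V k)
    (ω : Source V k) (X : V → Fin k) : Prop :=
  ∃ t : ℕ, ¬ SomeBadEvent G ε (run G ε σ ω t).current ∧ (run G ε σ ω t).current = X

end FairPartition

end

noncomputable section

set_option linter.unusedSectionVars false

/-! ### The resampling argument of Moser and Tardos, with stable layers as witnesses -/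

namespace MoserTardos

variable {V ι A : Type*} [DecidableEq V] [DecidableEq ι]

/-! A desirable partition is one avoiding all bad events, so everything follows once resampling is
shown to stop after few steps in expectation; existence is then a by-product, since an almost sure
event is nonempty.

Resampling is analysed as by Moser and Tardos. A run reads a fixed random table, and its log records
the resampled events. For each log entry with event `B`, the older log is read backwards and
compressed into layers of independent events below the root `B`. This witness fixes which table
entry every event in it read, so it can be checked in the table alone (`witness_occurs`). Different
log entries have different witnesses (`length_le_occurrences`). Distinct layers read disjoint
entries, so a witness holds with probability equal to the product of its event probabilities
(`infinitePi_occurs`). Under the condition `p i * ∏ (1 + y j) ≤ y i`, with `j` over the events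
dependent on `i`, including `i`, the total over witnesses with root `i` is at most `y i`
(`sum_weight_le`). This is the asymmetric local lemma with `y = x / (1 - x)`.

Chernoff bounds supply the probabilities. The global event gets `y = 1` and each node event gets `ε²
/ (16kΔ²)` (`lllWeight_condition`); their sum gives the bound on iterations. Fairness is
deterministic: in a desirable partition high-degree nodes see nearly equal parts, while for
low-degree nodes the additive slack exceeds the degree. -/

/-- Two events are dependent if they share a variable. -/
abbrev Dep (vbl : ι → Finset V) (i j : ι) : Prop := ¬ Disjoint (vbl i) (vbl j)

/-- Some event of the layers `w` is dependent on `b`. -/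
abbrev Meets (vbl : ι → Finset V) (b : ι) (w : List (Finset ι)) : Prop :=
  ∃ L ∈ w, ∃ a ∈ L, Dep vbl a b

/-- The number of times that the events of the layers `w` involve the variable `v`. -/
def depth (vbl : ι → Finset V) : List (Finset ι) → V → ℕ
  | [], _ => 0
  | L :: w, v => (L.filter fun i => v ∈ vbl i).card + depth vbl w v

/-- The number of times that the events of a log involve the variable `v`. -/
def logCount (vbl : ι → Finset V) : List ι → V → ℕ
  | [], _ => 0
  | b :: ℓ, v => logCount vbl ℓ v + if v ∈ vbl b then 1 else 0

/-- A log of resampled events (latest first) is consistent with the table `ω` if every event was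
true when it was resampled. -/
def LogConsistent (vbl : ι → Finset V) (bad : ι → (V → A) → Prop) (ω : V × ℕ → A) :
    List ι → Prop
  | [] => True
  | b :: ℓ => LogConsistent vbl bad ω ℓ ∧ bad b fun v => ω (v, logCount vbl ℓ v)

/-- Add an earlier event `b` to the layers `w` that lie below the layer `L`: it enters the layer
just below the lowest one on which it depends, and is dropped if there is none. -/
def place (vbl : ι → Finset V) (b : ι) : Finset ι → List (Finset ι) → List (Finset ι)
  | L, [] => if ∃ a ∈ L, Dep vbl a b then [{b}] else []
  | L, M :: w =>
    if Meets vbl b (M :: w) then M :: place vbl b M w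
    else if ∃ a ∈ L, Dep vbl a b then insert b M :: w else M :: w

/-- All events of the layers hold in the table `ω`, where each variable is read at the position
given by the number of its occurrences in lower layers, shifted by `r`. -/
def Occurs (vbl : ι → Finset V) (bad : ι → (V → A) → Prop) (ω : V × ℕ → A) (r : V → ℕ) :
    List (Finset ι) → Prop
  | [] => True
  | L :: w => Occurs vbl bad ω r w ∧ ∀ i ∈ L, bad i fun v => ω (v, depth vbl w v + r v)

/-- Every layer is nonempty and consists of independent events, each dependent on an event of the
previous layer. -/
def Layered (vbl : ι → Finset V) : Finset ι → List (Finset ι) → Prop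
  | _, [] => True
  | L, M :: w => M.Nonempty ∧ (M : Set ι).PairwiseDisjoint vbl ∧
      (∀ b ∈ M, ∃ a ∈ L, Dep vbl a b) ∧ Layered vbl M w

/-- The layers below the root `B` that witness the resampling of `B` after the log `ℓ`. -/
def witness (vbl : ι → Finset V) (B : ι) (ℓ : List ι) : List (Finset ι) :=
  ℓ.foldl (fun w b => place vbl b {B} w) []

variable {vbl : ι → Finset V} {bad : ι → (V → A) → Prop} {ω : V × ℕ → A}

lemma depth_eq_zero {b : ι} {v : V} (hv : v ∈ vbl b) :
    ∀ {w : List (Finset ι)}, ¬ Meets vbl b w → depth vbl w v = 0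
  | [], _ => rfl
  | L :: w, h => by
    have h1 : depth vbl w v = 0 :=
      depth_eq_zero hv fun ⟨M, hM, x⟩ => h ⟨M, List.mem_cons_of_mem _ hM, x⟩
    have h2 : L.filter (fun i => v ∈ vbl i) = ∅ := by
      refine Finset.filter_eq_empty_iff.2 fun a ha hva => h ⟨L, List.mem_cons_self, a, ha, ?_⟩
      exact Finset.not_disjoint_iff.2 ⟨v, hva, hv⟩
    simp [depth, h1, h2]

lemma place_of_not_meets {b : ι} :
    ∀ {L : Finset ι} {w : List (Finset ι)}, ¬ Meets vbl b (L :: w) → place vbl b L w = w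
  | L, [], h => if_neg fun h' => h ⟨L, List.mem_cons_self, h'⟩
  | L, M :: w, h => by
    rw [place, if_neg fun ⟨N, hN, x⟩ => h ⟨N, List.mem_cons_of_mem _ hN, x⟩,
      if_neg fun h' => h ⟨L, List.mem_cons_self, h'⟩]

lemma meets_cons {b : ι} {L : Finset ι} {w : List (Finset ι)} :
    Meets vbl b (L :: w) ↔ (∃ a ∈ L, Dep vbl a b) ∨ Meets vbl b w := by
  simp [Meets]

/-- An event with a variable depends on itself. Hence inserting `b` into a layer never merges it
with an existing copy, and depths count correctly. -/
lemma notMem_of_not_meets (hne : ∀ i, (vbl i).Nonempty) {b : ι} {L : Finset ι}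
    {w : List (Finset ι)} (h : ¬ Meets vbl b (L :: w)) : b ∉ L := fun hb =>
  h ⟨L, List.mem_cons_self, b, hb, by simpa [Dep, disjoint_self] using (hne b).ne_empty⟩

lemma depth_place (hne : ∀ i, (vbl i).Nonempty) {b : ι} (v : V) :
    ∀ {L : Finset ι} {w : List (Finset ι)}, Meets vbl b (L :: w) →
      depth vbl (place vbl b L w) v = depth vbl w v + if v ∈ vbl b then 1 else 0
  | L, [], h => by
    have h' : ∃ a ∈ L, Dep vbl a b := by simpa [Meets] using h
    rw [place, if_pos h']
    by_cases hv : v ∈ vbl b <;> simp [depth, Finset.filter_singleton, hv]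
  | L, M :: w, h => by
    rw [place]
    by_cases h1 : Meets vbl b (M :: w)
    · rw [if_pos h1, depth, depth_place hne v h1, depth, add_assoc]
    · have hb := notMem_of_not_meets hne h1
      rw [if_neg h1, if_pos ((meets_cons.1 h).resolve_right h1), depth, depth,
        Finset.filter_insert]
      by_cases hv : v ∈ vbl b
      · rw [if_pos hv, if_pos hv, Finset.card_insert_of_notMem (by simp [hb])]; omega
      · simp [hv]

lemma Occurs.congr (hloc : ∀ i X Y, (∀ v ∈ vbl i, X v = Y v) → bad i X → bad i Y) {b : ι}
    {r r' : V → ℕ} (hr : ∀ v ∉ vbl b, r v = r' v) :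
    ∀ {w : List (Finset ι)}, ¬ Meets vbl b w → Occurs vbl bad ω r w → Occurs vbl bad ω r' w
  | [], _, _ => trivial
  | L :: w, h, ⟨h1, h2⟩ => by
    rw [meets_cons, not_or] at h
    refine ⟨Occurs.congr hloc hr h.2 h1, fun i hi => hloc i _ _ (fun v hv => ?_) (h2 i hi)⟩
    have : v ∉ vbl b := fun hvb => h.1 ⟨i, hi, Finset.not_disjoint_iff.2 ⟨v, hv, hvb⟩⟩
    simp only [hr v this]

/-- If `b` is placed, every layer event sharing a variable with it lies above it, so the depth
gained there makes up for the lost shift. If `b` is dropped, no layer event reads a variable of `b`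
and the shift is irrelevant. -/
lemma Occurs.place (hne : ∀ i, (vbl i).Nonempty)
    (hloc : ∀ i X Y, (∀ v ∈ vbl i, X v = Y v) → bad i X → bad i Y) {b : ι} {r : V → ℕ}
    (hb : bad b fun v => ω (v, r v)) :
    ∀ {L : Finset ι} {w : List (Finset ι)},
      Occurs vbl bad ω (fun v => r v + if v ∈ vbl b then 1 else 0) (L :: w) →
      Occurs vbl bad ω r (L :: place vbl b L w) := by
  intro L w h
  by_cases hm : Meets vbl b (L :: w)
  swap
  · rw [place_of_not_meets hm]
    exact Occurs.congr hloc (b := b) (fun v hv => by simp [hv]) hm h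
  refine ⟨?_, fun i hi => ?_⟩
  swap
  · have := h.2 i hi
    simp only [depth_place hne _ hm]
    convert this using 4
    ring
  induction w generalizing L with
  | nil =>
    have h' : ∃ a ∈ L, Dep vbl a b := by simpa [Meets] using hm
    rw [MoserTardos.place, if_pos h']
    simpa [Occurs, depth] using hb
  | cons M w ih =>
    rw [MoserTardos.place]
    by_cases h1 : Meets vbl b (M :: w)
    · rw [if_pos h1]
      refine ⟨ih h.1 h1, fun i hi => ?_⟩
      have := h.1.2 i hi
      simp only [depth_place hne _ h1]
      convert this using 4
      ring
    · rw [if_neg h1, if_pos ((meets_cons.1 hm).resolve_right h1)]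
      have h2 : Occurs vbl bad ω r (M :: w) :=
        Occurs.congr hloc (b := b) (fun v hv => by simp [hv]) h1 h.1
      refine ⟨h2.1, fun i hi => ?_⟩
      rcases Finset.mem_insert.1 hi with rfl | hi
      · refine hloc i _ _ (fun v hv => ?_) hb
        rw [depth_eq_zero hv fun ⟨N, hN, x⟩ => h1 ⟨N, List.mem_cons_of_mem _ hN, x⟩, zero_add]
      · exact h2.2 i hi

lemma Layered.place {b : ι} : ∀ {L : Finset ι} {w : List (Finset ι)},
    Layered vbl L w → Layered vbl L (place vbl b L w)
  | L, [], _ => by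
    rw [MoserTardos.place]
    split_ifs with h
    · simpa [Layered] using h
    · trivial
  | L, M :: w, ⟨h1, h2, h3, h4⟩ => by
    rw [MoserTardos.place]
    split_ifs with h h'
    · exact ⟨h1, h2, h3, Layered.place h4⟩
    · rw [meets_cons, not_or] at h
      refine ⟨Finset.insert_nonempty _ _, ?_, ?_, ?_⟩
      · rw [Finset.coe_insert]
        refine h2.insert fun a ha _ => ?_
        by_contra hd
        exact h.1 ⟨a, ha, fun hd' => hd hd'.symm⟩
      · intro c hc
        rcases Finset.mem_insert.1 hc with rfl | hc
        · exact h'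
        · exact h3 c hc
      -- Enlarging a layer keeps the layer beneath it supported.
      · cases w with
        | nil => trivial
        | cons N w =>
          refine ⟨h4.1, h4.2.1, fun c hc => ?_, h4.2.2.2⟩
          obtain ⟨a, ha, x⟩ := h4.2.2.1 c hc
          exact ⟨a, Finset.mem_insert_of_mem ha, x⟩
    · exact ⟨h1, h2, h3, h4⟩

lemma length_place {b : ι} : ∀ {L : Finset ι} {w : List (Finset ι)},
    (place vbl b L w).length ≤ w.length + 1
  | L, [] => by rw [place]; split_ifs <;> simp
  | L, M :: w => by
    rw [place]
    split_ifs
    · simpa using length_place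
    · simp
    · simp

/-! ### Witnesses extracted from a log -/

section Witness

lemma witness_occurs (hne : ∀ i, (vbl i).Nonempty)
    (hloc : ∀ i X Y, (∀ v ∈ vbl i, X v = Y v) → bad i X → bad i Y) {B : ι} {ℓ : List ι}
    (h : LogConsistent vbl bad ω (B :: ℓ)) :
    Occurs vbl bad ω (fun _ => 0) ({B} :: witness vbl B ℓ) := by
  -- Invariant while reading back in time: the layers occur when each variable is shifted by its
  -- count in the log still unread. The shift ends at `0`.
  have key : ∀ (ℓ : List ι) (w : List (Finset ι)), LogConsistent vbl bad ω ℓ →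
      Occurs vbl bad ω (logCount vbl ℓ) ({B} :: w) →
      Occurs vbl bad ω (fun _ => 0) ({B} :: ℓ.foldl (fun w b => place vbl b {B} w) w) := by
    intro ℓ
    induction ℓ with
    | nil => intro w _ h; exact h
    | cons b ℓ ih => intro w hℓ h; exact ih _ hℓ.1 (Occurs.place hne hloc hℓ.2 h)
  refine key ℓ [] h.1 ⟨trivial, fun i hi => ?_⟩
  rw [Finset.mem_singleton.1 hi]
  simpa [depth] using h.2

lemma witness_layered (B : ι) (ℓ : List ι) : Layered vbl {B} (witness vbl B ℓ) := by
  have key : ∀ (ℓ : List ι) (w : List (Finset ι)), Layered vbl {B} w →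
      Layered vbl {B} (ℓ.foldl (fun w b => place vbl b {B} w) w) := by
    intro ℓ
    induction ℓ with
    | nil => intro w h; exact h
    | cons b ℓ ih => intro w h; exact ih _ (Layered.place h)
  exact key ℓ [] trivial

lemma length_witness (B : ι) (ℓ : List ι) : (witness vbl B ℓ).length ≤ ℓ.length := by
  have key : ∀ (ℓ : List ι) (w : List (Finset ι)),
      (ℓ.foldl (fun w b => place vbl b {B} w) w).length ≤ w.length + ℓ.length := by
    intro ℓ
    induction ℓ with
    | nil => intro w; simp
    | cons b ℓ ih =>
      intro w
      have h1 := ih (place vbl b {B} w)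
      have h2 : (place vbl b {B} w).length ≤ w.length + 1 := length_place
      simp only [List.foldl_cons, List.length_cons]
      omega
  simpa [witness] using key ℓ []

/-- Every older event involving a variable of the root depends on the root, so it is never dropped.
-/
lemma depth_witness (hne : ∀ i, (vbl i).Nonempty) {B : ι} {v : V} (hv : v ∈ vbl B)
    (ℓ : List ι) : depth vbl (witness vbl B ℓ) v = logCount vbl ℓ v := by
  have key : ∀ (ℓ : List ι) (w : List (Finset ι)),
      depth vbl (ℓ.foldl (fun w b => place vbl b {B} w) w) v
        = depth vbl w v + logCount vbl ℓ v := by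
    intro ℓ
    induction ℓ with
    | nil => intro w; rfl
    | cons b ℓ ih =>
      intro w
      rw [List.foldl_cons, ih, logCount]
      by_cases hm : Meets vbl b ({B} :: w)
      · rw [depth_place hne v hm]; omega
      · have : v ∉ vbl b := fun hvb =>
          hm ⟨{B}, List.mem_cons_self, B, by simp, Finset.not_disjoint_iff.2 ⟨v, hv, hvb⟩⟩
        rw [place_of_not_meets hm, if_neg this]; rfl
  simpa [witness, depth] using key ℓ []

end Witness

/-! ### Counting witnesses and summing their weights -/

section Counting

variable [Fintype ι]

open Classical in
/-- The possible layers below the layer `J`. -/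
def nextLayers (vbl : ι → Finset V) (J : Finset ι) : Finset (Finset ι) :=
  (Finset.univ.filter fun i => ∃ j ∈ J, Dep vbl j i).powerset.filter fun I =>
    I.Nonempty ∧ (I : Set ι).PairwiseDisjoint vbl

/-- All ways to continue the layer `J` downwards by at most `d` layers. -/
def layerings (vbl : ι → Finset V) : ℕ → Finset ι → Finset (List (Finset ι))
  | 0, _ => {[]}
  | d + 1, J =>
    insert [] ((nextLayers vbl J).biUnion fun I => (layerings vbl d I).image (List.cons I))

lemma mem_layerings : ∀ {d : ℕ} {J : Finset ι} {w : List (Finset ι)},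
    w ∈ layerings vbl d J ↔ Layered vbl J w ∧ w.length ≤ d
  | 0, J, w => by
    cases w <;> simp [layerings, Layered]
  | d + 1, J, [] => by simp [layerings, Layered]
  | d + 1, J, M :: w => by
    have h : (M :: w ∈ layerings vbl (d + 1) J) ↔
        M ∈ nextLayers vbl J ∧ w ∈ layerings vbl d M := by
      simp [layerings]
    rw [h, mem_layerings]
    simp only [nextLayers, Finset.mem_filter, Finset.mem_powerset, Layered, List.length_cons,
      Finset.subset_iff, Finset.mem_univ, true_and, Nat.add_le_add_iff_right]
    tauto

open Classical in
/-- The number of layerings with a single root and at most `d` further layers that hold in `ω`. -/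
def occurrences (vbl : ι → Finset V) (bad : ι → (V → A) → Prop) (d : ℕ) (ω : V × ℕ → A) : ℕ :=
  ∑ i, ((layerings vbl d {i}).filter fun w =>
    Occurs vbl bad ω (fun _ => 0) ({i} :: w)).card

/-- Two log entries with the same event have different witnesses: between them the count of each
variable of that event has grown, and the witness records this count as its depth. -/
theorem length_le_occurrences (hne : ∀ i, (vbl i).Nonempty)
    (hloc : ∀ i X Y, (∀ v ∈ vbl i, X v = Y v) → bad i X → bad i Y) {ℓ : List ι}
    (h : LogConsistent vbl bad ω ℓ) {d : ℕ} (hd : ℓ.length ≤ d) :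
    ℓ.length ≤ occurrences vbl bad d ω := by
  classical
  set S : Finset (Σ _ : ι, List (Finset ι)) := Finset.univ.sigma fun i =>
    (layerings vbl d {i}).filter fun w => Occurs vbl bad ω (fun _ => 0) ({i} :: w) with hS
  -- The strict depth bound makes the next witness new: its depth at a root variable equals the
  -- current count.
  suffices H : ∃ T ⊆ S, T.card = ℓ.length ∧
      ∀ x ∈ T, ∀ v ∈ vbl x.1, depth vbl x.2 v < logCount vbl ℓ v by
    obtain ⟨T, hT, hc, -⟩ := H
    rw [← hc, occurrences, ← Finset.card_sigma]
    exact Finset.card_le_card hT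
  clear_value S
  induction ℓ with
  | nil => exact ⟨∅, by simp, rfl, by simp⟩
  | cons b ℓ ih =>
    simp only [List.length_cons] at hd
    obtain ⟨T, hT, hc, hlt⟩ := ih h.1 (by omega)
    have hnot : (⟨b, witness vbl b ℓ⟩ : Σ _ : ι, List (Finset ι)) ∉ T := by
      intro hmem
      obtain ⟨v, hv⟩ := hne b
      have := hlt _ hmem v hv
      rw [depth_witness hne hv] at this
      exact lt_irrefl _ this
    refine ⟨insert ⟨b, witness vbl b ℓ⟩ T, ?_, ?_, ?_⟩
    · refine Finset.insert_subset ?_ hT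
      rw [hS]
      simp only [Finset.mem_sigma, Finset.mem_univ, Finset.mem_filter, true_and]
      exact ⟨mem_layerings.2 ⟨witness_layered b ℓ, (length_witness b ℓ).trans (by omega)⟩,
        witness_occurs hne hloc h⟩
    · rw [Finset.card_insert_of_notMem hnot, hc, List.length_cons]
    · intro x hx v hv
      rw [logCount]
      rcases Finset.mem_insert.1 hx with rfl | hx
      · rw [depth_witness hne hv, if_pos hv]; omega
      · have := hlt x hx v hv; omega

/-- The weight of a sequence of layers. -/
def weight (p : ι → ℝ≥0∞) (w : List (Finset ι)) : ℝ≥0∞ := (w.map fun L => ∏ i ∈ L, p i).prod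

/-- Induct on the number of layers. The continuations through a next layer `I` contribute at most `∏
i ∈ I, y i`; summing over all subsets of the neighbourhood of `J` gives a product of factors `1 + y
j`, which the hypothesis absorbs. -/
lemma sum_weight_le {p y : ι → ℝ≥0∞}
    (hp : ∀ i, p i * ∏ j ∈ Finset.univ.filter (fun j => Dep vbl i j), (1 + y j) ≤ y i) :
    ∀ (d : ℕ) (J : Finset ι),
      (∏ i ∈ J, p i) * ∑ w ∈ layerings vbl d J, weight p w ≤ ∏ i ∈ J, y i := by
  have hprod : ∀ J : Finset ι, (∏ i ∈ J, p i) *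
      ∏ j ∈ Finset.univ.filter (fun j => ∃ i ∈ J, Dep vbl i j), (1 + y j) ≤ ∏ i ∈ J, y i := by
    intro J
    -- A factor shared by several neighbourhoods may be repeated, since it is at least `1`.
    have h1 : ∏ j ∈ Finset.univ.filter (fun j => ∃ i ∈ J, Dep vbl i j), (1 + y j) ≤
        ∏ i ∈ J, ∏ j ∈ Finset.univ.filter (fun j => Dep vbl i j), (1 + y j) := by
      induction J using Finset.induction_on with
      | empty => simp
      | insert a J ha ih =>
        rw [Finset.prod_insert ha]
        refine le_trans ?_ (mul_le_mul_right ih _)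
        rw [← Finset.prod_union_inter]
        refine le_trans (le_of_eq ?_) (le_mul_of_one_le_right' (Finset.one_le_prod' ?_))
        · congr 1; ext j; simp
        · intro j _; exact le_self_add
    calc _ ≤ (∏ i ∈ J, p i) *
          ∏ i ∈ J, ∏ j ∈ Finset.univ.filter (fun j => Dep vbl i j), (1 + y j) := by gcongr
      _ = ∏ i ∈ J, (p i * ∏ j ∈ Finset.univ.filter (fun j => Dep vbl i j), (1 + y j)) :=
        Finset.prod_mul_distrib.symm
      _ ≤ _ := Finset.prod_le_prod' fun i _ => hp i
  intro d
  induction d with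
  | zero =>
    intro J
    refine le_trans ?_ (hprod J)
    gcongr
    simpa [layerings, weight] using Finset.one_le_prod' fun j _ => le_self_add
  | succ d ih =>
    intro J
    refine le_trans ?_ (hprod J)
    gcongr
    rw [layerings, Finset.sum_insert (by simp), Finset.prod_one_add]
    have h1 : ∑ w ∈ (nextLayers vbl J).biUnion fun I => (layerings vbl d I).image (List.cons I),
        weight p w ≤ ∑ I ∈ nextLayers vbl J, ∏ i ∈ I, y i := by
      rw [Finset.sum_biUnion]
      · refine Finset.sum_le_sum fun I _ => le_trans (le_of_eq ?_) (ih I)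
        rw [Finset.sum_image (by simp), Finset.mul_sum]
        simp [weight]
      · intro I _ I' _ hne
        rw [Function.onFun, Finset.disjoint_left]
        intro w hw hw'
        obtain ⟨x, -, rfl⟩ := Finset.mem_image.1 hw
        obtain ⟨x', -, h⟩ := Finset.mem_image.1 hw'
        exact hne (List.cons.inj h).1.symm
    refine le_trans (add_le_add_right h1 _) ?_
    -- Stopping at `J` has weight `1` and plays the part of the empty subset, which no next layer
    -- uses.
    have h2 : (∅ : Finset ι) ∉ nextLayers vbl J := by simp [nextLayers]
    have h3 : weight p [] = ∏ i ∈ (∅ : Finset ι), y i := by simp [weight]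
    rw [h3, ← Finset.sum_insert (f := fun I => ∏ i ∈ I, y i) h2]
    refine Finset.sum_le_sum_of_subset fun I hI => ?_
    rcases Finset.mem_insert.1 hI with rfl | hI
    · simp
    · simp only [nextLayers, Finset.mem_filter] at hI
      exact hI.1

end Counting

end MoserTardos

/-! ### Probability that a witness holds in a random table -/

namespace MoserTardos

section Probability

open ProbabilityTheory

variable {κ A : Type*} [Finite A] [MeasurableSpace A]
  [MeasurableSingletonClass A] {μ : Measure A} [IsProbabilityMeasure μ]

/-- A set of configurations that depends on finitely many coordinates is the preimage of a
measurable set under the restriction to them. -/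
lemma exists_preimage_restrict [Nonempty A] {S : Finset κ} {E : Set (κ → A)}
    (hE : DependsOn (fun ω => ω ∈ E) (S : Set κ)) :
    ∃ E' : Set (S → A), MeasurableSet E' ∧ E = (fun ω (i : S) => ω i) ⁻¹' E' := by
  obtain ⟨g, hg⟩ := dependsOn_iff_exists_comp.1 hE
  refine ⟨{x | g x}, Set.Finite.measurableSet (Set.toFinite _), ?_⟩
  ext ω
  exact Iff.of_eq (congrFun hg ω)

lemma measurableSet_of_dependsOn [Nonempty A] {S : Finset κ} {E : Set (κ → A)}
    (hE : DependsOn (fun ω => ω ∈ E) (S : Set κ)) : MeasurableSet E := by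
  obtain ⟨E', hE', rfl⟩ := exists_preimage_restrict hE
  exact (measurable_pi_lambda _ fun i => measurable_pi_apply _) hE'

/-- Events depending on disjoint finite sets of coordinates are independent. -/
lemma infinitePi_inter_of_dependsOn {S T : Finset κ} (hST : Disjoint S T) {E F : Set (κ → A)}
    (hE : DependsOn (fun ω => ω ∈ E) (S : Set κ)) (hF : DependsOn (fun ω => ω ∈ F) (T : Set κ)) :
    Measure.infinitePi (fun _ : κ => μ) (E ∩ F) =
      Measure.infinitePi (fun _ : κ => μ) E * Measure.infinitePi (fun _ : κ => μ) F := by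
  have : Nonempty A := μ.nonempty_of_neZero
  obtain ⟨E', hE', rfl⟩ := exists_preimage_restrict hE
  obtain ⟨F', hF', rfl⟩ := exists_preimage_restrict hF
  have hi : iIndepFun (fun (i : κ) (ω : κ → A) => ω i) (Measure.infinitePi fun _ : κ => μ) :=
    iIndepFun_infinitePi (X := fun _ x => x) fun _ => measurable_id
  exact (hi.indepFun_finset S T hST fun i => measurable_pi_apply i).measure_inter_preimage_eq_mul
    _ _ hE' hF'

end Probability

section Resampling

variable {V ι A : Type*} [DecidableEq V] [DecidableEq ι] [Fintype V]
  [Finite A] [MeasurableSpace A] [MeasurableSingletonClass A]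
  {μ : Measure A} [IsProbabilityMeasure μ]
  {vbl : ι → Finset V} {bad : ι → (V → A) → Prop}

/-- The probability of the event `i` under independent parts of law `μ`. -/
def eventProb (μ : Measure A) [IsProbabilityMeasure μ] (bad : ι → (V → A) → Prop) (i : ι) :
    ℝ≥0∞ :=
  Measure.infinitePi (fun _ : V => μ) {X | bad i X}

lemma dependsOn_forall_mem (hloc : ∀ i X Y, (∀ v ∈ vbl i, X v = Y v) → bad i X → bad i Y)
    (L : Finset ι) :
    DependsOn (fun X => X ∈ {X : V → A | ∀ i ∈ L, bad i X}) ((L.biUnion vbl : Finset V) : Set V) := by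
  intro X Y h
  refine propext ⟨fun H i hi => ?_, fun H i hi => ?_⟩
  · exact hloc i X Y (fun v hv => h v (by simpa using ⟨i, hi, hv⟩)) (H i hi)
  · exact hloc i Y X (fun v hv => (h v (by simpa using ⟨i, hi, hv⟩)).symm) (H i hi)

lemma infinitePi_forall_mem (hloc : ∀ i X Y, (∀ v ∈ vbl i, X v = Y v) → bad i X → bad i Y)
    {L : Finset ι} (hL : (L : Set ι).PairwiseDisjoint vbl) :
    Measure.infinitePi (fun _ : V => μ) {X | ∀ i ∈ L, bad i X} = ∏ i ∈ L, eventProb μ bad i := by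
  induction L using Finset.induction_on with
  | empty => simp
  | insert a L ha ih =>
    rw [Finset.coe_insert] at hL
    rw [Finset.prod_insert ha, ← ih (hL.subset (Set.subset_insert _ _)), eventProb,
      ← infinitePi_inter_of_dependsOn (S := vbl a) (T := L.biUnion vbl)]
    · congr 1; ext X; simp
    · rw [Finset.disjoint_biUnion_right]
      intro b hb
      exact hL (Set.mem_insert _ _) (Set.mem_insert_of_mem _ hb) fun h => ha (h ▸ hb)
    · simpa using dependsOn_forall_mem hloc {a}
    · exact dependsOn_forall_mem hloc L

/-- The entries of the table that are read below a given depth. -/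
def entriesBelow (c : V → ℕ) : Finset (V × ℕ) :=
  (Finset.univ : Finset V).biUnion fun v => (Finset.range (c v)).image (Prod.mk v)

lemma mem_entriesBelow {c : V → ℕ} {x : V × ℕ} : x ∈ entriesBelow c ↔ x.2 < c x.1 := by
  obtain ⟨v, m⟩ := x
  simp [entriesBelow]

lemma dependsOn_occurs (hloc : ∀ i X Y, (∀ v ∈ vbl i, X v = Y v) → bad i X → bad i Y) :
    ∀ w : List (Finset ι), DependsOn (fun ω => ω ∈ {ω | Occurs vbl bad ω (fun _ => 0) w})
      (entriesBelow (depth vbl w) : Set (V × ℕ))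
  | [] => fun _ _ _ => rfl
  | L :: w => by
    have key : ∀ ω ω' : V × ℕ → A,
        (∀ x ∈ (entriesBelow (depth vbl (L :: w)) : Set (V × ℕ)), ω x = ω' x) →
        Occurs vbl bad ω (fun _ => 0) (L :: w) → Occurs vbl bad ω' (fun _ => 0) (L :: w) := by
      intro ω ω' h H
      have h' : ∀ x : V × ℕ, x.2 < depth vbl (L :: w) x.1 → ω x = ω' x := fun x hx =>
        h x (Finset.mem_coe.2 (mem_entriesBelow.2 hx))
      refine ⟨?_, fun i hi => hloc i _ _ (fun v hv => ?_) (H.2 i hi)⟩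
      · refine (Iff.of_eq (dependsOn_occurs hloc w fun x hx => h' x ?_)).1 H.1
        exact (mem_entriesBelow.1 (Finset.mem_coe.1 hx)).trans_le (Nat.le_add_left _ _)
      · refine h' _ ?_
        have : 0 < (L.filter fun i => v ∈ vbl i).card :=
          Finset.card_pos.2 ⟨i, by simp [hi, hv]⟩
        simp only [depth, add_zero]
        omega
    intro ω ω' h
    exact propext ⟨key ω ω' h, key ω' ω fun x hx => (h x hx).symm⟩

/-- The top layer reads each variable at the first position not available to the lower layers, hence
is independent of them. Within a layer, the events have disjoint variables. -/
lemma infinitePi_occurs (hloc : ∀ i X Y, (∀ v ∈ vbl i, X v = Y v) → bad i X → bad i Y) :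
    ∀ w : List (Finset ι), (∀ L ∈ w, (L : Set ι).PairwiseDisjoint vbl) →
      Measure.infinitePi (fun _ : V × ℕ => μ) {ω | Occurs vbl bad ω (fun _ => 0) w}
        = weight (eventProb μ bad) w
  | [], _ => by simp [Occurs, weight]
  | L :: w, hw => by
    have ih := infinitePi_occurs hloc w fun M hM => hw M (List.mem_cons_of_mem _ hM)
    have : Nonempty A := μ.nonempty_of_neZero
    set f : V → V × ℕ := fun v => (v, depth vbl w v) with hf
    have hinj : Function.Injective f := fun v v' h => (Prod.mk.inj h).1
    have hset : {ω : V × ℕ → A | Occurs vbl bad ω (fun _ => 0) (L :: w)} =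
        {ω | Occurs vbl bad ω (fun _ => 0) w} ∩
          (fun ω v => ω (f v)) ⁻¹' {X : V → A | ∀ i ∈ L, bad i X} := by
      ext ω; rfl
    have hlayer := dependsOn_forall_mem hloc L (A := A)
    rw [hset, infinitePi_inter_of_dependsOn (S := entriesBelow (depth vbl w))
      (T := Finset.univ.image f), ih, ← Measure.map_apply]
    · rw [Measure.map_infinitePi_infinitePi_of_inj (P := fun _ => μ) hinj,
        infinitePi_forall_mem hloc (hw L List.mem_cons_self), mul_comm]
      simp [weight]
    · exact measurable_pi_lambda _ fun v => measurable_pi_apply _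
    · exact measurableSet_of_dependsOn hlayer
    · rw [Finset.disjoint_left]
      intro x hx hx'
      obtain ⟨v, -, rfl⟩ := Finset.mem_image.1 hx'
      exact lt_irrefl _ (mem_entriesBelow.1 hx)
    · exact dependsOn_occurs hloc w
    · intro ω ω' h
      exact hlayer fun v _ => h _ (by simp)

lemma Layered.pairwiseDisjoint : ∀ {J : Finset ι} {w : List (Finset ι)}, Layered vbl J w →
    ∀ L ∈ w, (L : Set ι).PairwiseDisjoint vbl
  | _, [], _ => by simp
  | _, M :: w, h => by
    intro L hL
    rcases List.mem_cons.1 hL with rfl | hL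
    · exact h.2.1
    · exact h.2.2.2.pairwiseDisjoint L hL

/-- The expected number of witnesses that hold in a random table. -/
theorem lintegral_occurrences_le [Fintype ι]
    (hloc : ∀ i X Y, (∀ v ∈ vbl i, X v = Y v) → bad i X → bad i Y) {y : ι → ℝ≥0∞}
    (hp : ∀ i, eventProb μ bad i *
      ∏ j ∈ Finset.univ.filter (fun j => Dep vbl i j), (1 + y j) ≤ y i) (d : ℕ) :
    ∫⁻ ω, (occurrences vbl bad d ω : ℝ≥0∞) ∂(Measure.infinitePi fun _ : V × ℕ => μ) ≤
      ∑ i, y i := by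
  classical
  have : Nonempty A := μ.nonempty_of_neZero
  have hmeas : ∀ w, MeasurableSet {ω : V × ℕ → A | Occurs vbl bad ω (fun _ => 0) w} :=
    fun w => measurableSet_of_dependsOn (dependsOn_occurs hloc w)
  have hocc : ∀ ω : V × ℕ → A, (occurrences vbl bad d ω : ℝ≥0∞) =
      ∑ i, ∑ w ∈ layerings vbl d {i},
        {ω | Occurs vbl bad ω (fun _ => 0) ({i} :: w)}.indicator (fun _ => (1 : ℝ≥0∞)) ω := by
    intro ω
    simp only [occurrences, Finset.card_filter, Nat.cast_sum, Set.indicator_apply,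
      Set.mem_ofPred_eq, Nat.cast_ite, Nat.cast_one, Nat.cast_zero]
  simp_rw [hocc]
  rw [lintegral_finsetSum _ fun i _ => Finset.measurable_fun_sum _ fun w _ =>
    measurable_const.indicator (hmeas _)]
  refine Finset.sum_le_sum fun i _ => ?_
  rw [lintegral_finsetSum _ fun w _ => measurable_const.indicator (hmeas _)]
  refine le_trans (le_of_eq ?_) ((sum_weight_le hp d {i}).trans_eq (Finset.prod_singleton _ _))
  rw [Finset.mul_sum]
  refine Finset.sum_congr rfl fun w hw => ?_
  rw [lintegral_indicator_const (hmeas _), one_mul, infinitePi_occurs hloc]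
  · simp [weight]
  · intro L hL
    rcases List.mem_cons.1 hL with rfl | hL
    · simp
    · exact (mem_layerings.1 hw).1.pairwiseDisjoint L hL

end Resampling

end MoserTardos

/-! ### The algorithm as an instance of resampling -/

namespace FairPartition

open MoserTardos

variable {V : Type*} [Fintype V] [DecidableEq V] {k : ℕ} (G : SimpleGraph V)
  [DecidableRel G.Adj] (ε : ℝ)

/-- The nodes that are resampled for an event; `none` stands for the global event. -/
def resampledNodes : Option V → Finset V
  | none => Finset.univ
  | some i => insert i (G.neighborFinset i)

/-- The bad events; `none` stands for the global event. -/
def BadEvent : Option V → (V → Fin k) → Prop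
  | none, X => ¬ IsBalanced ε X
  | some i, X => NodeEvent G ε X i

variable {G ε}

lemma resampledNodes_nonempty [Nonempty V] (b : Option V) : (resampledNodes G b).Nonempty := by
  cases b with
  | none => exact Finset.univ_nonempty
  | some i => exact Finset.insert_nonempty _ _

lemma badEvent_congr (b : Option V) (X Y : V → Fin k)
    (h : ∀ v ∈ resampledNodes G b, X v = Y v) (hb : BadEvent G ε b X) : BadEvent G ε b Y := by
  cases b with
  | none =>
    have : X = Y := funext fun v => h v (Finset.mem_univ v)
    exact this ▸ hb
  | some i =>
    have he : ∀ j, edgesTo G i (part X j) = edgesTo G i (part Y j) := by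
      intro j
      unfold edgesTo part
      congr 1
      ext v
      simp only [Finset.mem_filter, Finset.mem_univ, true_and, and_congr_left_iff]
      intro hv
      rw [h v (Finset.mem_insert_of_mem ((G.mem_neighborFinset i v).2 hv))]
    refine ⟨hb.1, ?_⟩
    obtain ⟨j, hj⟩ := hb.2
    exact ⟨j, he j ▸ hj⟩

/-- The state `s` of a run arises by resampling the events of the log `ℓ`. -/
def Follows (G : SimpleGraph V) [DecidableRel G.Adj] (ε : ℝ) (ω : Source V k)
    (ℓ : List (Option V)) (s : RunState V k) : Prop :=
  LogConsistent (resampledNodes G) (BadEvent G ε) ω ℓ ∧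
    (s.current = fun v => ω (v, logCount (resampledNodes G) ℓ v)) ∧
    s.used = fun v => logCount (resampledNodes G) ℓ v + 1

/-- The initial draw uses entry `0`, so the current part of `v` sits at its log count and the next
fresh entry is one further. Resampling moves both by one. -/
lemma Follows.resample {ω : Source V k} {ℓ : List (Option V)} {s : RunState V k}
    (h : Follows G ε ω ℓ s) {b : Option V} (hb : BadEvent G ε b s.current) :
    Follows G ε ω (b :: ℓ) (resample ω (resampledNodes G b) s) := by
  refine ⟨⟨h.1, h.2.1 ▸ hb⟩, ?_, ?_⟩
  · funext v
    simp only [FairPartition.resample, h.2.1, h.2.2, logCount]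
    split_ifs <;> rfl
  · funext v
    simp only [FairPartition.resample, h.2.2, logCount]
    split_ifs <;> rfl

/-- Each iteration logs one or two events: the global one, a node event, or both. -/
lemma exists_follows_run {σ : SelectionRule V k} (hσ : σ.IsValid G ε) (ω : Source V k) :
    ∀ t : ℕ, (∀ t' < t, SomeBadEvent G ε (run G ε σ ω t').current) →
      ∃ ℓ, Follows G ε ω ℓ (run G ε σ ω t) ∧ t ≤ ℓ.length ∧ ℓ.length ≤ 2 * t
  | 0, _ => ⟨[], ⟨trivial, rfl, rfl⟩, le_rfl, le_rfl⟩
  | t + 1, h => by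
    obtain ⟨ℓ, hℓ, h1, h2⟩ := exists_follows_run hσ ω t fun t' ht' => h t' (by omega)
    have hbad := h t (Nat.lt_succ_self t)
    have hnode : ∀ {ℓ' s}, Follows G ε ω ℓ' s → (∃ i, NodeEvent G ε s.current i) →
        ∃ b, Follows G ε ω (b :: ℓ') (nodeStep G ε σ ω s) := fun {ℓ' s} hs hi => by
      rw [nodeStep, if_pos hi]
      exact ⟨some _, hs.resample (b := some (σ s.current s.past)) (hσ _ _ hi)⟩
    rw [run, if_pos hbad, globalStep]
    generalize run G ε σ ω t = s at *
    by_cases hB : IsBalanced ε s.current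
    · rw [if_neg (not_not.2 hB)]
      obtain ⟨b, hb⟩ := hnode hℓ (hbad.resolve_left (not_not.2 hB))
      exact ⟨_, hb, by simpa using h1, by simp only [List.length_cons]; omega⟩
    · rw [if_pos hB]
      have hg := hℓ.resample (b := none) hB
      simp only [resampledNodes] at hg
      by_cases hN : ∃ i, NodeEvent G ε (FairPartition.resample ω Finset.univ s).current i
      · obtain ⟨b, hb⟩ := hnode hg hN
        exact ⟨_, hb, by simp only [List.length_cons]; omega,
          by simp only [List.length_cons]; omega⟩
      · rw [nodeStep, if_neg hN]
        exact ⟨_, hg, by simp only [List.length_cons]; omega,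
          by simp only [List.length_cons]; omega⟩

lemma someBadEvent_of_lt_iterations {σ : SelectionRule V k} {ω : Source V k} {t : ℕ}
    (h : (t : ℕ∞) < iterations G ε σ ω) : SomeBadEvent G ε (run G ε σ ω t).current := by
  by_contra hb
  exact absurd h (not_lt.2 (iInf₂_le t hb))

lemma min_iterations_le_occurrences [Nonempty V] {σ : SelectionRule V k} (hσ : σ.IsValid G ε)
    (ω : Source V k) (t : ℕ) :
    min (iterations G ε σ ω) t ≤ (occurrences (resampledNodes G) (BadEvent G ε) (2 * t) ω : ℕ∞) := by
  obtain ⟨m, hm⟩ := ENat.ne_top_iff_exists.1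
    (ne_top_of_le_ne_top (ENat.natCast_ne_top t) (min_le_right (iterations G ε σ ω) t))
  rw [← hm]
  have hmi : (m : ℕ∞) ≤ iterations G ε σ ω := hm ▸ min_le_left _ _
  have hmt : m ≤ t := by exact_mod_cast (hm ▸ min_le_right _ _ : (m : ℕ∞) ≤ t)
  obtain ⟨ℓ, hℓ, h1, h2⟩ := exists_follows_run hσ ω m fun t' ht' =>
    someBadEvent_of_lt_iterations ((Nat.cast_lt.2 ht').trans_le hmi)
  exact_mod_cast h1.trans
    (length_le_occurrences resampledNodes_nonempty badEvent_congr hℓ.1 (h2.trans (by omega)))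

/-! ### Measurability of the run and of the iteration count -/

section Measurability

/-- Sets of states are all measurable. -/
instance : MeasurableSpace (RunState V k) := ⊤

instance : DiscreteMeasurableSpace (RunState V k) := ⟨fun _ => trivial⟩

instance : Countable (RunState V k) := by
  refine Function.Injective.countable
    (f := fun s : RunState V k => (s.current, s.past, s.used)) ?_
  rintro ⟨a, b, c⟩ ⟨a', b', c'⟩ h
  simp only [Prod.mk.injEq] at h
  obtain ⟨rfl, rfl, rfl⟩ := h
  rfl

/-- There are only countably many states, so it suffices to check measurability for each fixed
state. -/
lemma measurable_comp_state {F : Source V k → RunState V k → RunState V k}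
    (hF : ∀ s, Measurable fun ω => F ω s) {g : Source V k → RunState V k} (hg : Measurable g) :
    Measurable fun ω => F ω (g ω) :=
  (measurable_from_prod_countable_left (f := fun x : Source V k × RunState V k => F x.1 x.2)
    hF).comp (measurable_id.prodMk hg)

lemma measurable_mk_state (p : List (V → Fin k)) (u : V → ℕ) {g : Source V k → V → Fin k}
    (hg : Measurable g) : Measurable fun ω => (⟨g ω, p, u⟩ : RunState V k) :=
  (Measurable.of_discrete (f := fun X : V → Fin k => (⟨X, p, u⟩ : RunState V k))).comp hg

lemma measurable_resample (B : Finset V) (s : RunState V k) :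
    Measurable fun ω : Source V k => resample ω B s := by
  refine measurable_mk_state _ _ (measurable_pi_lambda _ fun v => ?_)
  split_ifs
  · exact measurable_pi_apply _
  · exact measurable_const

lemma measurable_run (σ : SelectionRule V k) :
    ∀ t, Measurable fun ω : Source V k => run G ε σ ω t
  | 0 => measurable_mk_state (V := V) [] (fun _ => 1)
      (measurable_pi_lambda _ fun v => measurable_pi_apply (v, 0))
  | t + 1 => by
    classical
    have hglobal : ∀ s, Measurable fun ω : Source V k => globalStep ε ω s := fun s => by
      unfold globalStep
      split_ifs
      exacts [measurable_const, measurable_resample Finset.univ s]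
    have hnode : ∀ s, Measurable fun ω : Source V k => nodeStep G ε σ ω s := fun s => by
      unfold nodeStep
      split_ifs
      exacts [measurable_resample (insert _ (G.neighborFinset _)) s, measurable_const]
    simp only [run]
    refine measurable_comp_state (F := fun ω s => if SomeBadEvent G ε s.current then
      nodeStep G ε σ ω (globalStep ε ω s) else s) (fun s => ?_) (measurable_run σ t)
    split_ifs
    · exact measurable_comp_state hnode (hglobal s)
    · exact measurable_const

lemma measurable_iterations (σ : SelectionRule V k) :
    Measurable fun ω : Source V k => (iterations G ε σ ω : ℝ≥0∞) := by
  classical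
  have h : ∀ ω : Source V k, (iterations G ε σ ω : ℝ≥0∞) =
      ⨅ t : ℕ, if SomeBadEvent G ε (run G ε σ ω t).current then ⊤ else (t : ℝ≥0∞) := by
    intro ω
    rw [iterations, ENat.toENNReal_iInf]
    refine iInf_congr fun t => ?_
    split_ifs with hb <;> simp [hb]
  simp_rw [h]
  refine Measurable.iInf fun t => ?_
  exact (Measurable.of_discrete (f := fun s : RunState V k =>
    if SomeBadEvent G ε s.current then ⊤ else (t : ℝ≥0∞))).comp (measurable_run σ t)

end Measurability

/-- The expected number of iterations under the asymmetric Lovász local lemma condition. -/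
theorem lintegral_iterations_le [Nonempty V] [NeZero k] {σ : SelectionRule V k}
    (hσ : σ.IsValid G ε) {y : Option V → ℝ≥0∞}
    (hy : ∀ b, eventProb (PMF.uniformOfFintype (Fin k)).toMeasure (BadEvent G ε) b *
      ∏ c ∈ Finset.univ.filter (fun c => Dep (resampledNodes G) b c), (1 + y c) ≤ y b) :
    ∫⁻ ω, (iterations G ε σ ω : ℝ≥0∞) ∂(sourceLaw V k) ≤ ∑ b, y b := by
  -- Witnesses are counted only up to a finite depth, so the count is truncated at `t` and monotone
  -- convergence removes the truncation.
  have hsup : ∀ ω : Source V k, (iterations G ε σ ω : ℝ≥0∞) =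
      ⨆ t : ℕ, min (iterations G ε σ ω : ℝ≥0∞) t := by
    intro ω
    rw [← inf_iSup_eq, ENNReal.iSup_natCast, inf_top_eq]
  rw [lintegral_congr hsup, lintegral_iSup]
  · refine iSup_le fun t => le_trans (lintegral_mono fun ω => ?_)
      (lintegral_occurrences_le (μ := (PMF.uniformOfFintype (Fin k)).toMeasure)
        badEvent_congr hy (2 * t))
    have := ENat.toENNReal_le.2 (min_iterations_le_occurrences hσ ω t)
    simpa using this
  · exact fun t => (measurable_iterations σ).min measurable_const
  · exact fun t t' h ω => min_le_min_left _ (Nat.cast_le.2 h)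

lemma exists_returns_of_iterations_lt_top {σ : SelectionRule V k} {ω : Source V k}
    (h : (iterations G ε σ ω : ℝ≥0∞) < ⊤) : ∃ X, Returns G ε σ ω X := by
  by_contra hcon
  have hbad : ∀ t, SomeBadEvent G ε (run G ε σ ω t).current := fun t => by
    by_contra hb
    exact hcon ⟨_, t, hb, rfl⟩
  simp [iterations, hbad] at h

lemma isDesirable_of_not_someBadEvent {X : V → Fin k} (h : ¬ SomeBadEvent G ε X) :
    IsDesirable G ε X := by
  simp only [SomeBadEvent, not_or, not_not, not_exists] at h
  refine ⟨h.1, fun i hi j => ?_⟩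
  by_contra hj
  exact h.2 i ⟨hi, j, hj⟩

end FairPartition

/-! ### Desirable partitions are fair -/

namespace FairPartition

section Fairness

variable {V : Type*} [Fintype V] {k : ℕ} {G : SimpleGraph V} [DecidableRel G.Adj] {ε : ℝ}

lemma edgesTo_le_degree (i : V) (S : Finset V) : edgesTo G i S ≤ G.degree i := by
  rw [← SimpleGraph.card_neighborFinset_eq_degree]
  exact Finset.card_le_card fun v hv =>
    (G.mem_neighborFinset i v).2 (Finset.mem_filter.1 hv).2

lemma edgesTo_part (i : V) (X : V → Fin k) (j : Fin k) :
    edgesTo G i (part X j) = ((G.neighborFinset i).filter fun v => X v = j).card := by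
  unfold edgesTo part
  congr 1
  ext v
  simp [and_comm]

lemma utility_eq_degree (X : V → Fin 1) (i : V) : utility G X i = G.degree i := by
  rw [utility, edgesTo_part, ← SimpleGraph.card_neighborFinset_eq_degree]
  congr 1
  ext v
  simpa using fun _ => Subsingleton.elim _ _

lemma log_card_le_logTerm (hΔ : 1 ≤ G.maxDegree) (hk : 1 ≤ k) (h0 : 0 < ε) (h1 : ε ≤ 1) :
    Real.log k ≤ logTerm G k ε := by
  have hΔ' : (1 : ℝ) ≤ G.maxDegree := by exact_mod_cast hΔ
  have hk' : (1 : ℝ) ≤ k := by exact_mod_cast hk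
  refine Real.log_le_log (by linarith) ?_
  rw [le_div_iff₀ h0]
  nlinarith

lemma logTerm_nonneg (hΔ : 1 ≤ G.maxDegree) (hk : 1 ≤ k) (h0 : 0 < ε) (h1 : ε ≤ 1) :
    0 ≤ logTerm G k ε :=
  (Real.log_nonneg (by exact_mod_cast hk)).trans (log_card_le_logTerm hΔ hk h0 h1)

lemma log_two_le_logTerm (hΔ : 1 ≤ G.maxDegree) (hk : 2 ≤ k) (h0 : 0 < ε) (h1 : ε ≤ 1) :
    Real.log 2 ≤ logTerm G k ε :=
  (Real.log_le_log (by norm_num) (by exact_mod_cast hk)).trans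
    (log_card_le_logTerm hΔ (by omega) h0 h1)

/-- At high degree, two parts differ by at most two deviations, `8√(deg/k · L)`. At low degree, envy
is below the degree, hence below `12kL`. With a single part there is none. -/
theorem IsDesirable.isEnvyFree (hΔ : 1 ≤ G.maxDegree) (hk : 1 ≤ k) (h0 : 0 < ε) (h1 : ε ≤ 1)
    {X : V → Fin k} (hX : IsDesirable G ε X) :
    IsEnvyFree G (12 * max √((G.maxDegree : ℝ) / k) (k : ℝ) * logTerm G k ε) X := by
  have hL := logTerm_nonneg hΔ hk h0 h1
  set L := logTerm G k ε with hLdef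
  intro i j
  have hr : 0 ≤ 12 * max √((G.maxDegree : ℝ) / k) (k : ℝ) * L :=
    mul_nonneg (mul_nonneg (by norm_num) ((Real.sqrt_nonneg _).trans (le_max_left _ _))) hL
  rcases hk.eq_or_lt with rfl | hk2
  · rw [utility, Subsingleton.elim j (X i), sub_self]; exact hr
  have hL2 : Real.log 2 ≤ L := log_two_le_logTerm hΔ hk2 h0 h1
  have hlog2 := Real.log_two_gt_d9
  have hu : (0 : ℝ) ≤ utility G X i := Nat.cast_nonneg _
  by_cases hd : 12 * k * L ≤ (G.degree i : ℝ)
  · have hj := (hX.2 i hd j).2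
    have hi := (hX.2 i hd (X i)).1
    change _ ≤ (utility G X i : ℝ) at hi
    have hdeg : (G.degree i : ℝ) ≤ G.maxDegree := by exact_mod_cast G.degree_le_maxDegree i
    have h2 : √((G.degree i : ℝ) / k * L) ≤ √((G.maxDegree : ℝ) / k) * √L := by
      rw [Real.sqrt_mul (by positivity)]
      gcongr
    -- This needs `L ≥ 4/9`, which `L ≥ ln 2` gives; then `8 · 3/2 = 12`.
    have h3 : √L ≤ 3 / 2 * L := by
      rw [Real.sqrt_le_left (by linarith)]
      nlinarith
    have h4 : √((G.maxDegree : ℝ) / k) * √L ≤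
        max √((G.maxDegree : ℝ) / k) (k : ℝ) * (3 / 2 * L) :=
      mul_le_mul (le_max_left _ _) h3 (Real.sqrt_nonneg _)
        ((Real.sqrt_nonneg _).trans (le_max_left _ _))
    linarith
  · have h2 : (edgesTo G i (part X j) : ℝ) ≤ G.degree i := by exact_mod_cast edgesTo_le_degree i _
    have h3 : (k : ℝ) * L ≤ max √((G.maxDegree : ℝ) / k) (k : ℝ) * L := by
      gcongr; exact le_max_right _ _
    linarith

/-- No single node can gain enough, whatever the size of the coalition, because its utility there is
at most its degree. -/
theorem IsDesirable.inCore (hΔ : 1 ≤ G.maxDegree) (hk : 1 ≤ k) (h0 : 0 < ε) (h1 : ε ≤ 1)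
    {X : V → Fin k} (hX : IsDesirable G ε X) :
    InCore G ε ((k : ℝ) + √(k : ℝ)) (16 * (k : ℝ) ^ (3 / 2 : ℝ) * logTerm G k ε) X := by
  have hL := logTerm_nonneg hΔ hk h0 h1
  set L := logTerm G k ε with hLdef
  rintro S - ⟨⟨i, hiS⟩, hS⟩
  have hi := hS i hiS
  have hk' : (1 : ℝ) ≤ k := by exact_mod_cast hk
  have hk0 : (0 : ℝ) ≤ k := by linarith
  have hpow : (k : ℝ) ^ (3 / 2 : ℝ) = k * √k := by
    rw [Real.sqrt_eq_rpow, ← Real.rpow_one_add' hk0 (by norm_num)]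
    norm_num
  rw [hpow] at hi
  have hd : (edgesTo G i S : ℝ) ≤ G.degree i := by exact_mod_cast edgesTo_le_degree i S
  have hu : (0 : ℝ) ≤ utility G X i := Nat.cast_nonneg _
  set s := √(k : ℝ) with hs
  have hs1 : 1 ≤ s := Real.one_le_sqrt.2 hk'
  have hss : s * s = k := Real.mul_self_sqrt hk0
  have hαu : 0 ≤ ((k : ℝ) + s) * utility G X i := by positivity
  by_cases h : 12 * k * L ≤ (G.degree i : ℝ)
  · have hlow := (hX.2 i h (X i)).1
    change _ ≤ (utility G X i : ℝ) at hlow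
    set a := √((G.degree i : ℝ) / k) with ha
    set b := √L with hb
    have haa : a * a = (G.degree i : ℝ) / k := Real.mul_self_sqrt (by positivity)
    have hbb : b * b = L := Real.mul_self_sqrt hL
    rw [Real.sqrt_mul (by positivity), ← ha, ← hb, ← haa] at hlow
    have hdeg : (G.degree i : ℝ) = s * s * (a * a) := by
      rw [haa, hss]; field_simp
    have hmul : ((k : ℝ) + s) * (a * a - 4 * (a * b)) ≤ (k + s) * utility G X i := by gcongr
    rw [← hss, ← hbb] at hi
    rw [← hss] at hmul
    have hb0 : 0 ≤ b := Real.sqrt_nonneg _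
    -- With `s = √k`, `a = √(deg/k)`, `b = √L`, blocking would force `a² - 4(s+1)ab + 16s²b² < 0`.
    -- Completing the square leaves `16s² - 4(s+1)² = 4(s-1)(3s+1)`.
    have key : 0 ≤ s * ((a - 2 * (s + 1) * b) ^ 2 + 4 * (s - 1) * (3 * s + 1) * (b * b)) := by
      have h1 : 0 ≤ s - 1 := by linarith
      positivity
    nlinarith
  · nlinarith [mul_le_mul_of_nonneg_left hs1 (mul_nonneg hk0 hL)]

end Fairness

end FairPartition

/-! ### Chernoff bounds for a uniformly random partition -/

namespace FairPartition

section Chernoff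

variable {V : Type*} [Fintype V] [DecidableEq V] {k : ℕ} [NeZero k]

/-- The law of a uniformly random partition. -/
abbrev partitionLaw (V : Type*) (k : ℕ) [NeZero k] : Measure (V → Fin k) :=
  Measure.infinitePi fun _ : V => (PMF.uniformOfFintype (Fin k)).toMeasure

/-- Independence factors the integral; each factor is bounded using `exp s ≤ 1 + s + s²` for `|s| ≤
1`. Both signs of `s` are needed for the two tails. -/
lemma integral_exp_card_le (T : Finset V) (j : Fin k) {s : ℝ} (hs : |s| ≤ 1) :
    ∫ X, Real.exp (s * ((T.filter fun v => X v = j).card : ℝ)) ∂(partitionLaw V k) ≤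
      Real.exp ((T.card : ℝ) / k * (s + s ^ 2)) := by
  have hk : (0 : ℝ) < k := by exact_mod_cast Nat.pos_of_ne_zero (NeZero.ne k)
  have h1 : ∀ X : V → Fin k, Real.exp (s * ((T.filter fun v => X v = j).card : ℝ)) =
      ∏ v, (if v ∈ T then (if X v = j then Real.exp s else 1) else 1) := by
    intro X
    rw [Finset.prod_ite_mem, Finset.univ_inter, ← Finset.prod_filter, Finset.prod_const,
      ← Real.exp_nat_mul, mul_comm]
  have h2 : ∫ x : Fin k, (if x = j then Real.exp s else 1)
      ∂(PMF.uniformOfFintype (Fin k)).toMeasure = 1 + (Real.exp s - 1) / k := by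
    rw [PMF.integral_eq_sum]
    have : ∀ x : Fin k, ((PMF.uniformOfFintype (Fin k)) x).toReal • (if x = j then Real.exp s else 1)
        = (k : ℝ)⁻¹ + if x = j then (Real.exp s - 1) / k else 0 := by
      intro x
      split_ifs
      · simp; ring
      · simp
    simp_rw [this]
    rw [Finset.sum_add_distrib]
    simp [hk.ne']
  have h3 : 1 + (Real.exp s - 1) / k ≤ Real.exp ((s + s ^ 2) / k) := by
    refine le_trans ?_ (Real.add_one_le_exp _)
    have := (abs_le.1 (Real.abs_exp_sub_one_sub_id_le hs)).2
    rw [add_comm]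
    gcongr
    linarith
  have h4 : 0 ≤ 1 + (Real.exp s - 1) / k := by
    rw [← h2]
    exact integral_nonneg fun x => by positivity
  simp_rw [h1]
  rw [partitionLaw, Measure.infinitePi_eq_pi,
    integral_fintype_prod_eq_prod (𝕜 := ℝ)
      (fun v (x : Fin k) => if v ∈ T then (if x = j then Real.exp s else 1) else 1)]
  have h5 : ∀ v, ∫ x : Fin k, (if v ∈ T then (if x = j then Real.exp s else 1) else 1)
      ∂(PMF.uniformOfFintype (Fin k)).toMeasure =
      if v ∈ T then 1 + (Real.exp s - 1) / k else 1 := by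
    intro v
    split_ifs
    · exact h2
    · simp
  simp_rw [h5]
  rw [Finset.prod_ite_mem, Finset.univ_inter, Finset.prod_const]
  calc _ ≤ Real.exp ((s + s ^ 2) / k) ^ T.card := by gcongr
    _ = _ := by rw [← Real.exp_nat_mul]; congr 1; ring

lemma measureReal_le_mul_card_le (T : Finset V) (j : Fin k) {s : ℝ} (hs : |s| ≤ 1) (b : ℝ) :
    (partitionLaw V k).real
      {X | b ≤ s * (((T.filter fun v => X v = j).card : ℝ) - (T.card : ℝ) / k)} ≤
      Real.exp ((T.card : ℝ) / k * s ^ 2 - b) := by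
  have h := ProbabilityTheory.measure_ge_le_exp_mul_mgf (μ := partitionLaw V k)
    (X := fun X => s * ((T.filter fun v => X v = j).card : ℝ)) (b + s * ((T.card : ℝ) / k))
    (t := 1) zero_le_one Integrable.of_finite
  simp only [ProbabilityTheory.mgf, one_mul] at h
  calc _ = (partitionLaw V k).real {X | b + s * ((T.card : ℝ) / k) ≤
        s * ((T.filter fun v => X v = j).card : ℝ)} := by
        congr 1
        ext X
        simp only [Set.mem_ofPred_eq, mul_sub]
        constructor <;> intro h <;> linarith
    _ ≤ _ := h
    _ ≤ Real.exp (-1 * (b + s * ((T.card : ℝ) / k))) *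
        Real.exp ((T.card : ℝ) / k * (s + s ^ 2)) := by
        gcongr
        exact integral_exp_card_le T j hs
    _ = _ := by rw [← Real.exp_add]; congr 1; ring

/-- A Chernoff bound for the number of nodes of `T` in the part `j`. -/
lemma partitionLaw_deviation_le (T : Finset V) (j : Fin k) {a : ℝ} (ha : 0 ≤ a)
    (ha' : a ≤ 2 * ((T.card : ℝ) / k)) :
    partitionLaw V k
      {X | a ≤ |((T.filter fun v => X v = j).card : ℝ) - (T.card : ℝ) / k|} ≤
      ENNReal.ofReal (2 * Real.exp (-(a ^ 2 / (4 * ((T.card : ℝ) / k))))) := by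
  set m : ℝ := (T.card : ℝ) / k with hm
  have hm0 : 0 ≤ m := by positivity
  -- The minimiser of `m s² - s a`; the bound `a ≤ 2m` keeps it at most `1`. If `m = 0`, division by
  -- zero yields `s = 0`, which still works.
  set s : ℝ := a / (2 * m) with hs
  have hs0 : 0 ≤ s := by positivity
  have hs1 : |s| ≤ 1 := by
    rw [abs_of_nonneg hs0]
    exact div_le_one_of_le₀ ha' (by positivity)
  have hval : m * s ^ 2 - s * a = -(a ^ 2 / (4 * m)) := by
    rcases hm0.eq_or_lt with h | h
    · simp [hs, ← h]
    · rw [hs]; field_simp; ring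
  rw [← ofReal_measureReal]
  refine ENNReal.ofReal_le_ofReal ?_
  have hsub : {X : V → Fin k | a ≤ |((T.filter fun v => X v = j).card : ℝ) - m|} ⊆
      {X | s * a ≤ s * (((T.filter fun v => X v = j).card : ℝ) - m)} ∪
      {X | s * a ≤ -s * (((T.filter fun v => X v = j).card : ℝ) - m)} := by
    intro X hX
    rw [Set.mem_ofPred_eq] at hX
    rcases le_abs.1 hX with h | h
    · exact Or.inl (mul_le_mul_of_nonneg_left h hs0)
    · refine Or.inr ?_
      have := mul_le_mul_of_nonneg_left h hs0
      simp only [Set.mem_ofPred_eq]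
      linarith
  refine (measureReal_mono hsub).trans ((measureReal_union_le _ _).trans ?_)
  have h1 := measureReal_le_mul_card_le T j hs1 (s * a)
  have h2 := measureReal_le_mul_card_le T j (by rwa [abs_neg] : |(-s)| ≤ 1) (s * a)
  rw [neg_sq] at h2
  rw [← hm, hval] at h1 h2
  linarith

/-- The union bound over all parts. -/
lemma partitionLaw_exists_deviation_le (T : Finset V) {a : ℝ} (ha : 0 ≤ a)
    (ha' : a ≤ 2 * ((T.card : ℝ) / k)) :
    partitionLaw V k
      {X | ∃ j, a ≤ |((T.filter fun v => X v = j).card : ℝ) - (T.card : ℝ) / k|} ≤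
      ENNReal.ofReal (2 * k * Real.exp (-(a ^ 2 / (4 * ((T.card : ℝ) / k))))) := by
  have h : {X : V → Fin k | ∃ j, a ≤ |((T.filter fun v => X v = j).card : ℝ) - (T.card : ℝ) / k|}
      = ⋃ j, {X | a ≤ |((T.filter fun v => X v = j).card : ℝ) - (T.card : ℝ) / k|} := by
    ext X; simp
  rw [h]
  refine (measure_iUnion_fintype_le _ _).trans
    ((Finset.sum_le_sum fun j _ => partitionLaw_deviation_le T j ha ha').trans ?_)
  rw [Finset.sum_const, Finset.card_univ, Fintype.card_fin, nsmul_eq_mul,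
    ← ENNReal.ofReal_natCast, ← ENNReal.ofReal_mul (by positivity)]
  exact ENNReal.ofReal_le_ofReal (by linarith)

end Chernoff

/-! ### The local lemma condition for the bad events -/

section LocalLemma

open MoserTardos

variable {V : Type*} [Fintype V] [DecidableEq V] {k : ℕ} [NeZero k] {G : SimpleGraph V}
  [DecidableRel G.Adj] {ε : ℝ}

lemma eventProb_none_le (h0 : 0 < ε) (h1 : ε ≤ 1) :
    eventProb (PMF.uniformOfFintype (Fin k)).toMeasure (BadEvent (V := V) G ε) none ≤
      ENNReal.ofReal (2 * k * Real.exp (-(ε ^ 2 * Fintype.card V / k / 4))) := by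
  have hk : (0 : ℝ) < k := by exact_mod_cast Nat.pos_of_ne_zero (NeZero.ne k)
  set m : ℝ := (Fintype.card V : ℝ) / k with hm
  have hm0 : 0 ≤ m := by positivity
  have h := partitionLaw_exists_deviation_le (k := k) (Finset.univ : Finset V) (a := ε * m)
    (by positivity) (by rw [Finset.card_univ, ← hm]; nlinarith)
  rw [Finset.card_univ, ← hm] at h
  have hexp : (ε * m) ^ 2 / (4 * m) = ε ^ 2 * Fintype.card V / k / 4 := by
    rw [mul_div_assoc, ← hm]
    rcases hm0.eq_or_lt with h | h
    · simp [← h]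
    · field_simp
  rw [hexp] at h
  refine le_trans (measure_mono fun X hX => ?_) h
  simp only [BadEvent, IsBalanced, SizeInRange, Set.mem_ofPred_eq, not_forall, not_and_or,
    not_le] at hX
  obtain ⟨j, hj⟩ := hX
  refine ⟨j, ?_⟩
  change ε * m ≤ |((part X j).card : ℝ) - m|
  rcases hj with hj | hj
  · have h2 : ((part X j).card : ℝ) ≤ (1 - ε) * m := by
      refine le_trans ?_ (Int.floor_le _)
      exact_mod_cast hj.le
    refine le_trans ?_ (neg_le_abs _)
    linarith
  · have h2 : (1 + ε) * m ≤ ((part X j).card : ℝ) := by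
      refine (Int.le_ceil _).trans ?_
      exact_mod_cast hj.le
    refine le_trans ?_ (le_abs_self _)
    linarith

/-- The deviation `4√(mL)` with `m = deg/k` gives exponent `16mL/(4m) = 4L`; the degree threshold
keeps it in the Chernoff range. -/
lemma eventProb_some_le (i : V) (hL : 0 ≤ logTerm G k ε)
    (hd : 12 * k * logTerm G k ε ≤ (G.degree i : ℝ)) (hd0 : 0 < G.degree i) :
    eventProb (PMF.uniformOfFintype (Fin k)).toMeasure (BadEvent G ε) (some i) ≤
      ENNReal.ofReal (2 * k * Real.exp (-(4 * logTerm G k ε))) := by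
  have hk : (0 : ℝ) < k := by exact_mod_cast Nat.pos_of_ne_zero (NeZero.ne k)
  set L := logTerm G k ε with hLdef
  set m : ℝ := (G.degree i : ℝ) / k with hm
  have hm0 : 0 < m := by positivity
  have hLm : 12 * L ≤ m := by rw [hm, le_div_iff₀ hk]; linarith
  have h := partitionLaw_exists_deviation_le (k := k) (G.neighborFinset i) (a := 4 * √(m * L))
    (by positivity) (by
      rw [SimpleGraph.card_neighborFinset_eq_degree, ← hm]
      have : √(m * L) ≤ m / 2 := by
        rw [Real.sqrt_le_left (by positivity)]
        nlinarith
      linarith)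
  rw [SimpleGraph.card_neighborFinset_eq_degree, ← hm] at h
  have hexp : (4 * √(m * L)) ^ 2 / (4 * m) = 4 * L := by
    rw [mul_pow, Real.sq_sqrt (by positivity)]
    field_simp
  rw [hexp] at h
  refine le_trans (measure_mono fun X hX => ?_) h
  obtain ⟨-, j, hj⟩ := hX
  refine ⟨j, ?_⟩
  rw [edgesTo_part, ← hm, ← hLdef, Set.mem_Icc, not_and_or, not_le, not_le] at hj
  rcases hj with hj | hj
  · refine le_trans ?_ (neg_le_abs _)
    linarith
  · refine le_trans ?_ (le_abs_self _)
    linarith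

lemma card_resampledNodes_some_le (i : V) :
    (resampledNodes G (some i)).card ≤ G.maxDegree + 1 := by
  refine (Finset.card_insert_le _ _).trans ?_
  rw [SimpleGraph.card_neighborFinset_eq_degree]
  exact Nat.add_le_add_right (G.degree_le_maxDegree i) 1

/-- Dependent nodes have a common point in their closed neighbourhoods. -/
lemma card_dependent_le (i : V) :
    (Finset.univ.filter fun v => Dep (resampledNodes G) (some i) (some v)).card ≤
      (G.maxDegree + 1) * (G.maxDegree + 1) := by
  have hsub : (Finset.univ.filter fun v => Dep (resampledNodes G) (some i) (some v)) ⊆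
      (resampledNodes G (some i)).biUnion fun u => resampledNodes G (some u) := by
    intro v hv
    obtain ⟨u, hu, huv⟩ := Finset.not_disjoint_iff.1 (Finset.mem_filter.1 hv).2
    refine Finset.mem_biUnion.2 ⟨u, hu, ?_⟩
    simp only [resampledNodes, Finset.mem_insert, SimpleGraph.mem_neighborFinset] at huv ⊢
    exact huv.imp Eq.symm fun h => h.symm
  refine (Finset.card_le_card hsub).trans ((Finset.card_biUnion_le_card_mul _ _ _
    fun u _ => card_resampledNodes_some_le u).trans ?_)
  exact Nat.mul_le_mul_right _ (card_resampledNodes_some_le i)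

/-- The numbers with which the local lemma is applied. -/
def lllWeight (G : SimpleGraph V) [DecidableRel G.Adj] (k : ℕ) (ε : ℝ) : Option V → ℝ
  | none => 1
  | some _ => ε ^ 2 / (16 * k * (G.maxDegree : ℝ) ^ 2)

lemma lllWeight_nonneg (b : Option V) : 0 ≤ lllWeight G k ε b := by
  cases b <;> simp only [lllWeight] <;> positivity

/-- In the exponent, `1` pays for the global event and `c` for the dependent nodes. -/
lemma prod_lllWeight_le (b : Option V) {c : ℝ}
    (hc : (Finset.univ.filter fun v => Dep (resampledNodes G) b (some v)).card *
      (ε ^ 2 / (16 * k * (G.maxDegree : ℝ) ^ 2)) ≤ c) :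
    ∏ c ∈ Finset.univ.filter (fun c => Dep (resampledNodes G) b c),
        (1 + ENNReal.ofReal (lllWeight G k ε c)) ≤ ENNReal.ofReal (Real.exp (1 + c)) := by
  have h1 : ∀ c : Option V, 1 + ENNReal.ofReal (lllWeight G k ε c) =
      ENNReal.ofReal (1 + lllWeight G k ε c) := fun c => by
    rw [ENNReal.ofReal_add zero_le_one (lllWeight_nonneg c), ENNReal.ofReal_one]
  simp_rw [h1]
  rw [← ENNReal.ofReal_prod_of_nonneg fun c _ => add_nonneg zero_le_one (lllWeight_nonneg c)]
  refine ENNReal.ofReal_le_ofReal ((Real.prod_one_add_le_exp_sum _ fun c =>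
    lllWeight_nonneg c).trans (Real.exp_le_exp.2 ?_))
  rw [Finset.sum_filter, Fintype.sum_option, ← Finset.sum_filter]
  refine add_le_add ?_ (le_trans (le_of_eq ?_) hc)
  · split_ifs <;> simp [lllWeight]
  · simp [lllWeight]

lemma global_condition (hk : 2 ≤ k) {E c : ℝ} (hE : 36 * Real.log k ≤ E) (hc : c ≤ E / 16) :
    2 * k * Real.exp (-(E / 4)) * Real.exp (1 + c) ≤ 1 := by
  have hk' : (2 : ℝ) ≤ k := by exact_mod_cast hk
  have hlog : 0 ≤ Real.log k := Real.log_nonneg (by linarith)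
  have h1 : Real.exp (-(E / 4)) * Real.exp (1 + c) ≤ Real.exp 1 * ((k : ℝ) ^ 4)⁻¹ := by
    have h2 : ((k : ℝ) ^ 4)⁻¹ = Real.exp (-(4 * Real.log k)) := by
      rw [Real.exp_neg, show (4 : ℝ) = ((4 : ℕ) : ℝ) by norm_num, Real.exp_nat_mul,
        Real.exp_log (by linarith)]
    rw [h2, ← Real.exp_add, ← Real.exp_add]
    -- The exponent is at most `1 - 3E/16`, and `3 · 36/16 = 6.75` exceeds the required `4`.
    refine Real.exp_le_exp.2 ?_
    linarith
  have he := Real.exp_one_lt_d9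
  calc _ = 2 * k * (Real.exp (-(E / 4)) * Real.exp (1 + c)) := by ring
    _ ≤ 2 * k * (4 * ((k : ℝ) ^ 4)⁻¹) := by
      refine mul_le_mul_of_nonneg_left (h1.trans ?_) (by positivity)
      gcongr
      linarith
    _ = 8 / (k : ℝ) ^ 3 := by field_simp; norm_num
    _ ≤ 1 := by
      rw [div_le_one (by positivity)]
      calc (8 : ℝ) = 2 ^ 3 := by norm_num
        _ ≤ _ := by gcongr

lemma node_condition (hk : 2 ≤ k) {D c : ℝ} (hD : 16 ≤ D) (h0 : 0 < ε) (h1 : ε ≤ 1)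
    (hc : c ≤ 1 / 4) :
    2 * k * Real.exp (-(4 * Real.log (D * k / ε))) * Real.exp (1 + c) ≤
      ε ^ 2 / (16 * k * D ^ 2) := by
  have hk' : (2 : ℝ) ≤ k := by exact_mod_cast hk
  have hD0 : 0 < D := by linarith
  have he : Real.exp (1 + c) ≤ 8 := by
    have h2 : Real.exp (1 + c) ≤ Real.exp 1 * Real.exp 1 := by
      rw [← Real.exp_add]; exact Real.exp_le_exp.2 (by linarith)
    have := Real.exp_one_lt_d9
    have h3 := Real.exp_pos 1
    nlinarith
  have hq : Real.exp (-(4 * Real.log (D * k / ε))) = (ε / (D * k)) ^ 4 := by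
    rw [← mul_neg, ← Real.log_inv, inv_div, show (4 : ℝ) = ((4 : ℕ) : ℝ) by norm_num,
      Real.exp_nat_mul, Real.exp_log (by positivity)]
  rw [hq]
  -- The quotient of the two sides is at most `256ε²/(Dk)²`, so `Dk ≥ 16` would already suffice.
  have hDk : 32 ≤ D * k := by nlinarith
  have h2 : ε ^ 2 ≤ 1 := pow_le_one₀ h0.le h1
  calc _ ≤ 2 * k * (ε / (D * k)) ^ 4 * 8 := by gcongr
    _ = ε ^ 2 / (16 * k * D ^ 2) * (256 * ε ^ 2 / (D * k) ^ 2) := by field_simp; norm_num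
    _ ≤ ε ^ 2 / (16 * k * D ^ 2) * 1 := by
      gcongr
      rw [div_le_one (by positivity)]
      nlinarith
    _ = _ := mul_one _

lemma lllWeight_condition [Nonempty V] (hΔ : 1 ≤ G.maxDegree) (hk : 2 ≤ k) (h0 : 0 < ε)
    (h1 : ε ≤ 1) (hε : 6 * √((k : ℝ) * Real.log k / Fintype.card V) ≤ ε) (b : Option V) :
    eventProb (PMF.uniformOfFintype (Fin k)).toMeasure (BadEvent G ε) b *
      ∏ c ∈ Finset.univ.filter (fun c => Dep (resampledNodes G) b c),
        (1 + ENNReal.ofReal (lllWeight G k ε c)) ≤ ENNReal.ofReal (lllWeight G k ε b) := by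
  have hk' : (2 : ℝ) ≤ k := by exact_mod_cast hk
  have hΔ' : (1 : ℝ) ≤ G.maxDegree := by exact_mod_cast hΔ
  have hL2 := log_two_le_logTerm hΔ hk h0 h1
  have hlog2 := Real.log_two_gt_d9
  cases b with
  | none =>
    have hn : (0 : ℝ) < Fintype.card V := by exact_mod_cast Fintype.card_pos
    have hE : 36 * Real.log k ≤ ε ^ 2 * Fintype.card V / k := by
      have hlog : 0 ≤ Real.log k := Real.log_nonneg (by linarith)
      have h2 : √((k : ℝ) * Real.log k / Fintype.card V) ^ 2 ≤ (ε / 6) ^ 2 :=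
        pow_le_pow_left₀ (Real.sqrt_nonneg _) (by linarith) 2
      rw [Real.sq_sqrt (by positivity), div_le_iff₀ hn] at h2
      rw [le_div_iff₀ (by linarith)]
      linarith
    have hc : ((Finset.univ.filter fun v =>
        Dep (resampledNodes G) none (some v)).card : ℝ) *
        (ε ^ 2 / (16 * k * (G.maxDegree : ℝ) ^ 2)) ≤ ε ^ 2 * Fintype.card V / k / 16 := by
      calc _ ≤ (Fintype.card V : ℝ) * (ε ^ 2 / (16 * k * 1 ^ 2)) := by
            gcongr
            exact Finset.card_le_univ _
        _ = _ := by field_simp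
    refine (mul_le_mul' (eventProb_none_le h0 h1) (prod_lllWeight_le none hc)).trans ?_
    rw [← ENNReal.ofReal_mul (by positivity)]
    exact ENNReal.ofReal_le_ofReal (global_condition hk hE le_rfl)
  | some i =>
    by_cases hd : 12 * k * logTerm G k ε ≤ (G.degree i : ℝ)
    swap
    · have h2 : {X : V → Fin k | BadEvent G ε (some i) X} = ∅ :=
        Set.eq_empty_of_forall_notMem fun X hX => hd hX.1
      rw [eventProb, h2, measure_empty, zero_mul]
      exact zero_le
    -- Since `12kL ≥ 24 ln 2 > 16`.
    have hD : (16 : ℝ) ≤ G.degree i := by nlinarith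
    have hdeg : (G.degree i : ℝ) ≤ G.maxDegree := by exact_mod_cast G.degree_le_maxDegree i
    have hc : ((Finset.univ.filter fun v =>
        Dep (resampledNodes G) (some i) (some v)).card : ℝ) *
        (ε ^ 2 / (16 * k * (G.maxDegree : ℝ) ^ 2)) ≤ 1 / 4 := by
      have h2 : ((Finset.univ.filter fun v =>
          Dep (resampledNodes G) (some i) (some v)).card : ℝ) ≤
          ((G.maxDegree : ℝ) + 1) * (G.maxDegree + 1) := by
        exact_mod_cast card_dependent_le i
      -- Here `(Δ+1)² ≤ 4Δ²` dependent nodes, each of weight at most `1/(16Δ²)`.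
      calc _ ≤ (((G.maxDegree : ℝ) + G.maxDegree) * (G.maxDegree + G.maxDegree)) *
            (1 ^ 2 / (16 * 1 * (G.maxDegree : ℝ) ^ 2)) := by
            gcongr
            · exact h2.trans (by gcongr)
            · linarith
        _ = _ := by field_simp; norm_num
    refine (mul_le_mul' (eventProb_some_le i (by linarith) hd
      (by exact_mod_cast (by linarith : (0 : ℝ) < G.degree i)))
      (prod_lllWeight_le (some i) hc)).trans ?_
    rw [← ENNReal.ofReal_mul (by positivity)]
    exact ENNReal.ofReal_le_ofReal (node_condition hk (hD.trans hdeg) h0 h1 le_rfl)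

lemma not_badEvent_one {b : Option V} {X : V → Fin 1} (h0 : 0 < ε) :
    ¬ BadEvent G ε b X := by
  cases b with
  | none =>
    have hcard : ∀ j, (part X j).card = Fintype.card V := fun j => by
      rw [← Finset.card_univ]
      congr 1
      ext v
      simpa [part] using Subsingleton.elim _ _
    refine not_not.2 fun j => ?_
    rw [SizeInRange, hcard]
    have hn : (0 : ℝ) ≤ Fintype.card V := Nat.cast_nonneg _
    constructor
    · refine Int.floor_le_iff.2 ?_
      push_cast
      nlinarith
    · refine Int.le_ceil_iff.2 ?_
      push_cast
      nlinarith
  | some i =>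
    rintro ⟨-, j, hj⟩
    have h2 := utility_eq_degree (G := G) X i
    rw [utility, Subsingleton.elim (X i) j] at h2
    rw [h2] at hj
    have := Real.sqrt_nonneg ((G.degree i : ℝ) / (1 : ℕ) * logTerm G 1 ε)
    exact hj ⟨by push_cast at this ⊢; rw [div_one] at this ⊢; linarith,
      by push_cast at this ⊢; rw [div_one] at this ⊢; linarith⟩

/-- The bound on the expected number of iterations. -/
theorem lintegral_iterations_le_ofReal [Nonempty V] (hΔ : 1 ≤ G.maxDegree) (h0 : 0 < ε)
    (h1 : ε ≤ 1) (hε : 6 * √((k : ℝ) * Real.log k / Fintype.card V) ≤ ε)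
    {σ : SelectionRule V k} (hσ : σ.IsValid G ε) :
    ∫⁻ ω, (iterations G ε σ ω : ℝ≥0∞) ∂(sourceLaw V k) ≤
      ENNReal.ofReal (Fintype.card V * (ε ^ 2 / ((k : ℝ) * (G.maxDegree : ℝ) ^ 2)) + 1) := by
  have hk1 : 1 ≤ k := Nat.one_le_iff_ne_zero.2 (NeZero.ne k)
  rcases hk1.eq_or_lt with rfl | hk
  -- With one part no bad event can occur, so zero weights suffice.
  · refine (lintegral_iterations_le hσ (y := fun _ => 0) fun b => ?_).trans (by simp)
    have h2 : {X : V → Fin 1 | BadEvent G ε b X} = ∅ :=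
      Set.eq_empty_of_forall_notMem fun X => not_badEvent_one h0
    rw [eventProb, h2, measure_empty, zero_mul]
  · refine (lintegral_iterations_le hσ (lllWeight_condition hΔ hk h0 h1 hε)).trans ?_
    rw [← ENNReal.ofReal_sum_of_nonneg fun b _ => lllWeight_nonneg b]
    refine ENNReal.ofReal_le_ofReal ?_
    have hΔ' : (1 : ℝ) ≤ G.maxDegree := by exact_mod_cast hΔ
    simp only [Fintype.sum_option, lllWeight, Finset.sum_const, Finset.card_univ, nsmul_eq_mul]
    rw [add_comm]
    gcongr
    have : (0 : ℝ) < k := by positivity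
    linarith

end LocalLemma

end FairPartition

end

theorem mainTheorem2 {V : Type*} [Fintype V] [DecidableEq V] [Nonempty V]
    (G : SimpleGraph V) [DecidableRel G.Adj] (hΔ : 1 ≤ G.maxDegree)
    (k : ℕ) [NeZero k] (ε : ℝ) (hε_pos : 0 < ε)
    (hε : ε ∈ Set.Icc (6 * √((k : ℝ) * Real.log k / Fintype.card V)) 1) :
    -- a desirable partition exists, and it is balanced, envy-free and in the core
    (∃ X : V → Fin k,
      FairPartition.IsDesirable G ε X ∧
      FairPartition.IsBalanced ε X ∧
      FairPartition.IsEnvyFree G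
        (12 * max √((G.maxDegree : ℝ) / k) (k : ℝ) * Real.log ((G.maxDegree : ℝ) * k / ε)) X ∧
      FairPartition.InCore G ε ((k : ℝ) + √(k : ℝ))
        (16 * (k : ℝ) ^ (3 / 2 : ℝ) * Real.log ((G.maxDegree : ℝ) * k / ε)) X) ∧
    -- every desirable partition has these fairness properties
    (∀ X : V → Fin k, FairPartition.IsDesirable G ε X →
      FairPartition.IsEnvyFree G
        (12 * max √((G.maxDegree : ℝ) / k) (k : ℝ) * Real.log ((G.maxDegree : ℝ) * k / ε)) X ∧
      FairPartition.InCore G ε ((k : ℝ) + √(k : ℝ))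
        (16 * (k : ℝ) ^ (3 / 2 : ℝ) * Real.log ((G.maxDegree : ℝ) * k / ε)) X) ∧
    -- the algorithm, under any rule for selecting the node whose event is resampled
    (∀ σ : FairPartition.SelectionRule V k, FairPartition.SelectionRule.IsValid G ε σ →
      Measurable (fun ω => (FairPartition.iterations G ε σ ω : ℝ≥0∞)) ∧
      ∫⁻ ω, (FairPartition.iterations G ε σ ω : ℝ≥0∞) ∂(FairPartition.sourceLaw V k) ≤
        ENNReal.ofReal
          (Fintype.card V * (ε ^ 2 / ((k : ℝ) * (G.maxDegree : ℝ) ^ 2)) + 1) ∧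
      (∀ᵐ ω ∂(FairPartition.sourceLaw V k), ∃ X, FairPartition.Returns G ε σ ω X) ∧
      (∀ ω X, FairPartition.Returns G ε σ ω X →
        FairPartition.IsDesirable G ε X ∧
        FairPartition.IsBalanced ε X ∧
        FairPartition.IsEnvyFree G
          (12 * max √((G.maxDegree : ℝ) / k) (k : ℝ) *
            Real.log ((G.maxDegree : ℝ) * k / ε)) X ∧
        FairPartition.InCore G ε ((k : ℝ) + √(k : ℝ))
          (16 * (k : ℝ) ^ (3 / 2 : ℝ) * Real.log ((G.maxDegree : ℝ) * k / ε)) X)) := by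
  have hk : 1 ≤ k := Nat.one_le_iff_ne_zero.2 (NeZero.ne k)
  have hfair : ∀ X : V → Fin k, FairPartition.IsDesirable G ε X →
      FairPartition.IsEnvyFree G
        (12 * max √((G.maxDegree : ℝ) / k) (k : ℝ) * Real.log ((G.maxDegree : ℝ) * k / ε)) X ∧
      FairPartition.InCore G ε ((k : ℝ) + √(k : ℝ))
        (16 * (k : ℝ) ^ (3 / 2 : ℝ) * Real.log ((G.maxDegree : ℝ) * k / ε)) X := fun X hX =>
    ⟨hX.isEnvyFree hΔ hk hε_pos hε.2, hX.inCore hΔ hk hε_pos hε.2⟩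
  have hret : ∀ (σ : FairPartition.SelectionRule V k) ω X,
      FairPartition.Returns G ε σ ω X → FairPartition.IsDesirable G ε X := by
    rintro σ ω X ⟨t, ht, rfl⟩
    exact FairPartition.isDesirable_of_not_someBadEvent ht
  have hint := fun (σ : FairPartition.SelectionRule V k) hσ =>
    FairPartition.lintegral_iterations_le_ofReal hΔ hε_pos hε.2 hε.1 (σ := σ) hσ
  have hae : ∀ σ : FairPartition.SelectionRule V k, σ.IsValid G ε →
      ∀ᵐ ω ∂(FairPartition.sourceLaw V k), ∃ X, FairPartition.Returns G ε σ ω X := fun σ hσ => by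
    filter_upwards [ae_lt_top (FairPartition.measurable_iterations σ)
      (ne_top_of_le_ne_top ENNReal.ofReal_ne_top (hint σ hσ))] with ω hω
    exact FairPartition.exists_returns_of_iterations_lt_top hω
  refine ⟨?_, hfair, fun σ hσ => ⟨FairPartition.measurable_iterations σ, hint σ hσ, hae σ hσ,
    fun ω X hX => ⟨hret σ ω X hX, (hret σ ω X hX).1, hfair X (hret σ ω X hX)⟩⟩⟩
  classical
  obtain ⟨v₀⟩ := ‹Nonempty V›
  -- Existence needs just one valid rule; `v₀` is a default never used when some node event is true.
  set σ : FairPartition.SelectionRule V k := fun X _ =>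
    if h : ∃ i, FairPartition.NodeEvent G ε X i then h.choose else v₀ with hσ_def
  have hσ : σ.IsValid G ε := fun X _ h => by
    simp only [hσ_def, dif_pos h]
    exact h.choose_spec
  have : Nonempty V := ⟨v₀⟩
  have : IsProbabilityMeasure (FairPartition.sourceLaw V k) := by
    unfold FairPartition.sourceLaw; infer_instance
  obtain ⟨ω, X, hX⟩ := (hae σ hσ).exists
  exact ⟨X, hret σ ω X hX, (hret σ ω X hX).1, hfair X (hret σ ω X hX)⟩
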